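/- Let $p\ge 1$ and $n_1,\dots,n_p\in\mathbb N$, and let $V=\mathbb C^{n_1}\otimes\cdots\otimes\mathbb C^{n_p}$. Fix real inner products $\langle\cdot,\cdot\rangle_i$ on $\mathbb R^{n_i}$, extend them to complex bilinear forms on $\mathbb C^{n_i}$, and let $\langle\cdot,\cdot\rangle_{BW}$ be the induced Bombieri–Weyl bilinear form on $V$, given by $\langle x_1\otimes\cdots\otimes x_p,\,y_1\otimes\cdots\otimes y_p\rangle_{BW}=\prod_i\langle x_i,y_i\rangle_i$. Orthogonality refers to these bilinear forms, and all closures are Zariski closures. Let $X\subseteq V$ be the variety of tensors $x_1\otimes\cdots\otimes x_p$ of rank at most one. For an irreducible variety $Z\subseteq V$ let $N_zZ=(T_zZ)^\perp$ be the normal space at $z\in Z_{reg}$, and put $$\operatorname{Con}(Z)=\overline{\{(z,y): z\in Z_{reg},\ y\in N_zZ\}},\qquad Z^*=\overline{\pi_2(\operatorname{Con}(Z))},\qquad \mathcal E_{Z,Z^*}=\overline{\{(z,y,z+y):(z,y)\in\operatorname{Con}(Z)\}}.$$ For $A\subseteq X^*$ the data locus of $A$ is $\operatorname{DL}_A=\overline{\pi_3\big(\mathcal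 E_{X^*,X}\cap(A\times V\times V)\big)}$, where $\mathcal E_{X^*,X}$ is the variety $\mathcal E_{Z,Z^*}$ for $Z=X^*$. Define $\operatorname{DL}_1=X$ and $\operatorname{DL}_r=\operatorname{DL}_{X^*\cap \operatorname{DL}_{r-1}}$ for $r\ge 2$. The rank of $T\in V$ is the least number of decomposable tensors $x_1\otimes\cdots\otimes x_p$ with sum $T$, and the border rank of $T$ is the least $k$ such that $T$ lies in the closure of the set of tensors of rank at most $k$. A tensor $T$ is weakly orthogonally decomposable if $T=\sum_{k=1}^m x_1^k\otimes\cdots\otimes x_p^k$ for some $m\ge 0$ and some nonzero vectors $x_j^k\in\mathbb C^{n_j}$ with $\langle x_j^k,x_j^l\rangle_j=0$ for all $j$ and all $k\ne l$. Then for every $r\ge 1$: (a) $\operatorname{DL}_r\subseteq\operatorname{DL}_{r+1}$; (b) every $T\in\operatorname{DL}_r$ has border rank at most $r$; (c) $\operatorname{DL}_r$ contains every weakly orthogonally decomposable tensor of rank at most $r$. -/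

import Mathlib

noncomputable section

namespace TensorData

/-! ### Polynomials, Zariski closure, tangent spaces -/

/-- The Zariski closure of a subset `S` of a finite-dimensional complex vector space `W`: the common
zeros of all polynomial functions (polynomials in linear functionals) that vanish on `S`. -/
def zariskiClosure {W : Type*} [AddCommGroup W] [Module ℂ W] (S : Set W) : Set W :=
  {w | ∀ P : MvPolynomial (Module.Dual ℂ W) ℂ,
    (∀ s ∈ S, MvPolynomial.eval (fun l => l s) P = 0) → MvPolynomial.eval (fun l => l w) P = 0}

/-- The differential at `z` of a polynomial `f` in coordinates indexed by `ι`. -/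
def differentialAt {ι : Type*} [Fintype ι] (f : MvPolynomial ι ℂ) (z : ι → ℂ) :
    (ι → ℂ) →ₗ[ℂ] ℂ :=
  ∑ i, MvPolynomial.eval z (MvPolynomial.pderiv i f) • LinearMap.proj i

/-- The Zariski tangent space `T_z Z`: the vectors killed by the differentials at `z` of all
polynomials that vanish on `Z`. -/
def tangentSpace {ι : Type*} [Fintype ι] (Z : Set (ι → ℂ)) (z : ι → ℂ) :
    Submodule ℂ (ι → ℂ) :=
  ⨅ f : {f : MvPolynomial ι ℂ // ∀ w ∈ Z, MvPolynomial.eval w f = 0},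
    LinearMap.ker (differentialAt f.1 z)

/-- The regular points of an irreducible affine variety `Z`: the points at which the Jacobian rank
is maximal, that is, at which the tangent space has the smallest dimension (which is `dim Z`). -/
def regularLocus {ι : Type*} [Fintype ι] (Z : Set (ι → ℂ)) : Set (ι → ℂ) :=
  {z | z ∈ Z ∧ ∀ w ∈ Z,
    Module.finrank ℂ (tangentSpace Z z) ≤ Module.finrank ℂ (tangentSpace Z w)}

/-! ### Tensors and the Bombieri-Weyl form -/

/-- `ℂ^{n₁} ⊗ ⋯ ⊗ ℂ^{n_p}`, a tensor being given by its array of coordinates with respect to the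
basis `e_{a₁} ⊗ ⋯ ⊗ e_{a_p}`. -/
abbrev Tensor {p : ℕ} (n : Fin p → ℕ) : Type := ((i : Fin p) → Fin (n i)) → ℂ

/-- The decomposable tensor `x₁ ⊗ ⋯ ⊗ x_p`. -/
def outer {p : ℕ} {n : Fin p → ℕ} (x : (i : Fin p) → Fin (n i) → ℂ) : Tensor n :=
  fun a => ∏ i, x i (a i)

/-- The variety `X` of tensors of rank at most one. -/
def rankOne {p : ℕ} (n : Fin p → ℕ) : Set (Tensor n) :=
  Set.range (outer (n := n))

/-- The complex bilinear (not sesquilinear) extension of the real inner product with Gram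
matrix `A`. -/
def complexForm {m : ℕ} (A : Matrix (Fin m) (Fin m) ℝ) (x y : Fin m → ℂ) : ℂ :=
  ∑ a, ∑ b, (A a b : ℂ) * x a * y b

/-- The Bombieri-Weyl bilinear form of the inner products with Gram matrices `G i`. -/
def bombieriWeyl {p : ℕ} {n : Fin p → ℕ} (G : (i : Fin p) → Matrix (Fin (n i)) (Fin (n i)) ℝ)
    (S T : Tensor n) : ℂ :=
  ∑ a, ∑ b, (∏ i, (G i (a i) (b i) : ℂ)) * S a * T b

/-- On decomposable tensors the Bombieri-Weyl form is the product of the forms on the factors. -/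
theorem bombieriWeyl_outer {p : ℕ} {n : Fin p → ℕ}
    (G : (i : Fin p) → Matrix (Fin (n i)) (Fin (n i)) ℝ) (x y : (i : Fin p) → Fin (n i) → ℂ) :
    bombieriWeyl G (outer x) (outer y) = ∏ i, complexForm (G i) (x i) (y i) := by
  classical
  simp only [bombieriWeyl, outer, complexForm, Finset.prod_univ_sum, Fintype.piFinset_univ,
    ← Finset.prod_mul_distrib]

/-- The normal space `N_z Z`: the orthogonal complement of the tangent space. -/
def normalSpace {p : ℕ} {n : Fin p → ℕ} (G : (i : Fin p) → Matrix (Fin (n i)) (Fin (n i)) ℝ)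
    (Z : Set (Tensor n)) (z : Tensor n) : Set (Tensor n) :=
  {y | ∀ v ∈ tangentSpace Z z, bombieriWeyl G v y = 0}

/-! ### Conormal variety, dual variety, data loci -/

/-- The conormal variety `Con(Z)`, the closure of the pairs `(z, y)` with `z ∈ Z_reg` and
`y ∈ N_z Z`. -/
def conormal {p : ℕ} {n : Fin p → ℕ} (G : (i : Fin p) → Matrix (Fin (n i)) (Fin (n i)) ℝ)
    (Z : Set (Tensor n)) : Set (Tensor n × Tensor n) :=
  zariskiClosure {q | q.1 ∈ regularLocus Z ∧ q.2 ∈ normalSpace G Z q.1}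

/-- The dual variety `Z*`, realized in the same space by means of the Bombieri-Weyl form. -/
def dualVariety {p : ℕ} {n : Fin p → ℕ} (G : (i : Fin p) → Matrix (Fin (n i)) (Fin (n i)) ℝ)
    (Z : Set (Tensor n)) : Set (Tensor n) :=
  zariskiClosure (Prod.snd '' conormal G Z)

/-- The joint ED correspondence `ℰ_{Z, Z*}`, the closure of the triples `(z, y, z + y)` with
`(z, y) ∈ Con(Z)`. -/
def jointED {p : ℕ} {n : Fin p → ℕ} (G : (i : Fin p) → Matrix (Fin (n i)) (Fin (n i)) ℝ)
    (Z : Set (Tensor n)) : Set (Tensor n × Tensor n × Tensor n) :=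
  zariskiClosure {q | (q.1, q.2.1) ∈ conormal G Z ∧ q.2.2 = q.1 + q.2.1}

/-- The data locus `DL_A` of a subset `A` of the dual `X*` of the variety of tensors of rank at most
one, for the distance optimization problem on `X*`. -/
def dataLocus {p : ℕ} {n : Fin p → ℕ} (G : (i : Fin p) → Matrix (Fin (n i)) (Fin (n i)) ℝ)
    (A : Set (Tensor n)) : Set (Tensor n) :=
  zariskiClosure
    ((fun q => q.2.2) '' (jointED G (dualVariety G (rankOne n)) ∩ {q | q.1 ∈ A}))

/-- The sequence `DL_1 = X`, `DL_r = DL_{X* ∩ DL_{r-1}}` for `r ≥ 2`. The value at `0` is a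
placeholder that nothing depends on. -/
def DL {p : ℕ} {n : Fin p → ℕ} (G : (i : Fin p) → Matrix (Fin (n i)) (Fin (n i)) ℝ) :
    ℕ → Set (Tensor n)
  | 0 => ∅
  | 1 => rankOne n
  | r + 2 => dataLocus G (dualVariety G (rankOne n) ∩ DL G (r + 1))

/-! ### Rank, border rank, weakly orthogonal decompositions -/

/-- The rank of a tensor: the least number of decomposable tensors with sum `T`. -/
def tensorRank {p : ℕ} {n : Fin p → ℕ} (T : Tensor n) : ℕ :=
  sInf {k | ∃ x : Fin k → (i : Fin p) → Fin (n i) → ℂ, T = ∑ j, outer (x j)}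

/-- The border rank of a tensor: the least `k` such that `T` lies in the closure of the set of
tensors of rank at most `k`. -/
def borderRank {p : ℕ} {n : Fin p → ℕ} (T : Tensor n) : ℕ :=
  sInf {k | T ∈ zariskiClosure {S : Tensor n | tensorRank S ≤ k}}

/-- `T` is a sum of finitely many decomposable tensors with nonzero factors such that the factors of
different summands in the same position are orthogonal. -/
def IsWeaklyOrthDecomposable {p : ℕ} {n : Fin p → ℕ}
    (G : (i : Fin p) → Matrix (Fin (n i)) (Fin (n i)) ℝ) (T : Tensor n) : Prop :=
  ∃ (m : ℕ) (x : Fin m → (i : Fin p) → Fin (n i) → ℂ),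
    (∀ k i, x k i ≠ 0) ∧
    (∀ i k l, k ≠ l → complexForm (G i) (x k i) (x l i) = 0) ∧
    T = ∑ k, outer (x k)

end TensorData

end

/-! Everything rests on two facts about the conormal variety of X* and one about rank.

First fact: if x is decomposable with nonzero factors and y is orthogonal to all tensors obtained
from x by changing one factor, then (y, x) lies in Con(X*). The pairs (x, y) are parametrized
polynomially (`pointParam`, `normalParam`): a tuple of matrices moves a base pair consisting of the
basis tensor at an index a₀ and a tensor supported on the "far" indices, those differing from a₀ in
at least two positions. Each far index contributes two vanishing factors to the Bombieri-Weyl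
pairing of point and normal vector, so the pairing vanishes to second order when either one varies
alone. By `generic_smoothness`, tangent vectors at a general parameter are derivatives of the
parametrization. Hence a general parameter gives a normal pair for X, and its swap gives a normal
pair for X*.

Second fact: the second component of a point of Con(X*) is in X (`snd_mem_rankOne_of_mem_conormal`).
A normal vector of X* is, up to the Gram matrices, the gradient of an equation of X*. At a general
point, orthogonality to the lines in X* through that point confines the gradient to the near indices
and puts it in the kernel of a Hessian of maximal rank. On that kernel all Hessian quadratic forms
vanish, which forces the gradient to be decomposable. Gradients are polynomial and X is closed, so
this persists on all of X*.

Thus `DL G (r + 1)` is the closure of sums y + z with y in X* ∩ DL_r and z in X. This gives (b), one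
decomposable summand per step. Since (0, x) is in Con(X*) for x in X, DL_1 lies in DL_2, and (a)
follows because data loci are monotone in A.

For (c), r decomposable tensors that are pairwise orthogonal in two positions have their sum in DL_r
by the first fact. A weakly orthogonal decomposition may be longer than the rank, because isotropic
factors permit linear dependence, so it must be shortened. The substitution method does this. A
summand with two nonisotropic factors can be removed at the cost of exactly one unit of rank. If
every summand has at most one nonisotropic factor, the summands nonisotropic in position j are
replaced, for one j after another, by d terms while the rank bound drops by d. What remains has only
isotropic factors, and any decomposition of it can be projected to mutually orthogonal spans. -/

open TensorProduct
-- Derivations and the generic Jacobian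
-- Formal smoothness kills the first cotangent homology, so F ⊗ Ω_{R/k} injects into Ω_{F/k}. Over
-- the field F this injection splits, and the functional defined by δ extends along the splitting.
theorem exists_derivation_extension {k R F : Type} [Field k] [CommRing R] [Field F]
    [Algebra k R] [Algebra R F] [Algebra k F] [IsScalarTower k R F] [Algebra.FormallySmooth R F]
    (δ : Derivation k R F) : ∃ D : Derivation k F F, ∀ r, D (algebraMap R F r) = δ r := by
  have hinj : Function.Injective (KaehlerDifferential.mapBaseChange k R F) := by
    rw [injective_iff_map_eq_zero]
    intro x hx
    obtain ⟨y, rfl⟩ := (Algebra.H1Cotangent.exact_δ_mapBaseChange k R F x).mp hx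
    rw [Subsingleton.elim y 0, map_zero]
  obtain ⟨g, hg⟩ := LinearMap.exists_leftInverse_of_injective _
    (LinearMap.ker_eq_bot.mpr hinj)
  let φ : F ⊗[R] Ω[R⁄k] →ₗ[F] F := TensorProduct.AlgebraTensorModule.lift
    ((LinearMap.lsmul F (Ω[R⁄k] →ₗ[R] F)).flip δ.liftKaehlerDifferential)
  refine ⟨(φ.comp g).compDer (KaehlerDifferential.D k F), fun r => ?_⟩
  have h1 := congrArg (fun f => φ (f (1 ⊗ₜ[R] KaehlerDifferential.D k R r))) hg
  simpa [φ] using h1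

/-- The relations say precisely that y b ↦ v b is a well-defined derivation on the subalgebra k[y].
In characteristic zero F is formally smooth over the fraction field of k[y], hence over k[y], so the
derivation extends to F. -/
theorem exists_derivation_of_relations {β k F : Type} [Fintype β] [Field k] [CharZero k] [Field F]
    [Algebra k F] [Algebra.EssFiniteType k F] (y v : β → F)
    (h : ∀ f : MvPolynomial β k, MvPolynomial.aeval y f = 0 →
      ∑ b, v b * MvPolynomial.aeval y (MvPolynomial.pderiv b f) = 0) :
    ∃ D : Derivation k F F, ∀ b, D (y b) = v b := by
  classical
  let d : MvPolynomial β k →ₗ[k] F := ∑ b, (LinearMap.mulLeft k (v b)) ∘ₗ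
    (MvPolynomial.aeval y).toLinearMap ∘ₗ (MvPolynomial.pderiv b).toLinearMap
  have hd : ∀ f, d f = ∑ b, v b * MvPolynomial.aeval y (MvPolynomial.pderiv b f) := by
    intro f; simp [d, LinearMap.sum_apply]
  let R := (MvPolynomial.aeval (R := k) y).range
  have hs : ∀ r : R, ∃ f : MvPolynomial β k, MvPolynomial.aeval y f = (r : F) := fun r => r.2
  choose s hs using hs
  have hwd : ∀ f g, MvPolynomial.aeval y f = MvPolynomial.aeval y g → d f = d g := by
    intro f g hfg
    rw [← sub_eq_zero, ← map_sub, hd]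
    exact h _ (by rw [map_sub, hfg, sub_self])
  let δ : Derivation k R F := Derivation.mk'
    { toFun := fun r => d (s r)
      map_add' := fun a b => by
        rw [← map_add]; exact hwd _ _ (by simp [hs])
      map_smul' := fun c a => by
        rw [RingHom.id_apply, ← map_smul]; exact hwd _ _ (by simp [hs]) }
    (fun a b => by
      have : d (s (a * b)) = d (s a * s b) := hwd _ _ (by simp [hs])
      change d (s (a * b)) = a • d (s b) + b • d (s a)
      rw [this, hd, hd, hd, Finset.smul_sum, Finset.smul_sum, ← Finset.sum_add_distrib]
      refine Finset.sum_congr rfl fun i _ => ?_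
      simp only [Derivation.leibniz, map_add, smul_eq_mul, map_mul, hs, Algebra.smul_def,
        Subalgebra.algebraMap_def, Algebra.algebraMap_self_apply]
      ring)
  have : CharZero (FractionRing R) := by
    exact charZero_of_injective_algebraMap (R := k) (algebraMap k (FractionRing R)).injective
  let K := FractionRing R
  let _ : Algebra K F := FractionRing.liftAlgebra R F
  have : IsScalarTower R K F := inferInstance
  have : IsScalarTower k K F := IsScalarTower.of_algebraMap_eq fun x => by
    rw [IsScalarTower.algebraMap_apply k R F, IsScalarTower.algebraMap_apply R K F,
      ← IsScalarTower.algebraMap_apply k R K]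
  have : Algebra.EssFiniteType K F := Algebra.EssFiniteType.of_comp k K F
  have : Algebra.FormallySmooth K F := inferInstance
  have : Algebra.FormallySmooth R K := .of_isLocalization (nonZeroDivisors R)
  have : Algebra.FormallySmooth R F := .comp R K F
  obtain ⟨D, hD⟩ := exists_derivation_extension δ
  refine ⟨D, fun b => ?_⟩
  have h1 := hD ⟨y b, MvPolynomial.X b, by simp⟩
  have h2 : d (s ⟨y b, MvPolynomial.X b, by simp⟩) = d (MvPolynomial.X b) :=
    hwd _ _ (by simp [hs])
  have h3 : d (MvPolynomial.X b) = v b := by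
    rw [hd, Finset.sum_eq_single b] <;> simp +contextual [MvPolynomial.pderiv_X]
  exact h1.trans (h2.trans h3)

/-- Restates ker g ⊆ im J as a matrix identity, which survives clearing denominators and
specialization, unlike the inclusion itself. -/
theorem exists_id_eq_add {F U V W : Type*} [Field F] [AddCommGroup U] [Module F U]
    [AddCommGroup V] [Module F V] [AddCommGroup W] [Module F W] (J : U →ₗ[F] V) (g : V →ₗ[F] W)
    (h : LinearMap.ker g ≤ LinearMap.range J) :
    ∃ (B : V →ₗ[F] U) (C : W →ₗ[F] V), J ∘ₗ B + C ∘ₗ g = LinearMap.id := by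
  obtain ⟨q, hq⟩ := (LinearMap.ker g).exists_isCompl
  have : Function.Injective (g ∘ₗ q.subtype) := by
    rw [← LinearMap.ker_eq_bot, eq_bot_iff]
    intro x hx
    have := hq.disjoint.le_bot ⟨(show x.1 ∈ LinearMap.ker g from hx), x.2⟩
    simpa using this
  obtain ⟨C, hC⟩ := LinearMap.exists_leftInverse_of_injective _ (LinearMap.ker_eq_bot.mpr this)
  obtain ⟨S, hS⟩ := J.rangeRestrict.exists_rightInverse_of_surjective (by simp)
  have hr : ∀ v, v - (C (g v)).1 ∈ LinearMap.range J := fun v => h <| by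
    obtain ⟨a, ha, b, hb, rfl⟩ := Submodule.mem_sup.mp (hq.sup_eq_top.ge (Submodule.mem_top : v ∈ _))
    have h1 : C (g b) = ⟨b, hb⟩ := LinearMap.congr_fun hC ⟨b, hb⟩
    rw [map_add, LinearMap.mem_ker.mp ha, zero_add, h1]
    simpa using ha
  let P : V →ₗ[F] V := LinearMap.id - (q.subtype ∘ₗ C) ∘ₗ g
  have hP : ∀ v, P v ∈ LinearMap.range J := hr
  refine ⟨S ∘ₗ P.codRestrict _ hP, q.subtype ∘ₗ C, LinearMap.ext fun v => ?_⟩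
  have h2 : J (S (P.codRestrict _ hP v)) = P v :=
    congrArg Subtype.val (LinearMap.congr_fun hS ⟨_, hP v⟩)
  change J (S (P.codRestrict _ hP v)) + (C (g v)).1 = v
  rw [h2]
  exact sub_add_cancel v _

open MvPolynomial in
-- Over the function field F of the parameter space, a vector killed by the differentials of all
-- relations among the Φ b comes from a derivation of F. Such a derivation is a combination of
-- partial derivatives, so the vector is in the image of the Jacobian. The identity J B + C gr = 1
-- over F is cleared of denominators; g is the common denominator.
theorem generic_tangent_eq_range {ι β : Type} [Fintype ι] [Fintype β]
    (Φ : β → MvPolynomial ι ℂ) :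
    ∃ g : MvPolynomial ι ℂ, g ≠ 0 ∧ ∀ w, eval w g ≠ 0 → ∀ v : β → ℂ,
      (∀ f : MvPolynomial β ℂ, aeval Φ f = 0 →
        ∑ b, v b * eval w (aeval Φ (pderiv b f)) = 0) →
      ∃ u : ι → ℂ, ∀ b, v b = ∑ j, u j * eval w (pderiv j (Φ b)) := by
  classical
  let A := MvPolynomial ι ℂ
  let F := FractionRing A
  have : Algebra.EssFiniteType A F := .of_isLocalization _ (nonZeroDivisors A)
  have : Algebra.EssFiniteType ℂ F := .comp ℂ A F
  let y : β → F := fun b => algebraMap A F (Φ b)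
  have hy : ∀ f : MvPolynomial β ℂ, aeval y f = algebraMap A F (aeval Φ f) := fun f => by
    exact aeval_algebraMap_apply (R := ℂ) (B := F) Φ f
  have hinj : Function.Injective (algebraMap A F) := IsFractionRing.injective A F
  obtain ⟨s, hs⟩ := (isNoetherianRing_iff_ideal_fg (MvPolynomial β ℂ)).mp inferInstance
    (RingHom.ker (aeval (R := ℂ) Φ))
  have hsI : ∀ f ∈ s, aeval Φ f = 0 := fun f hf => by
    have : f ∈ RingHom.ker (aeval (R := ℂ) Φ) := hs ▸ Ideal.subset_span hf
    exact this
  let J : (ι → F) →ₗ[F] (β → F) :=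
    Matrix.mulVecLin (Matrix.of fun b j => algebraMap A F (pderiv j (Φ b)))
  let gr : (β → F) →ₗ[F] (s → F) :=
    Matrix.mulVecLin (Matrix.of fun (f : s) b => algebraMap A F (aeval Φ (pderiv b f.1)))
  have hker : LinearMap.ker gr ≤ LinearMap.range J := by
    intro v hv
    have hv' : ∀ f ∈ s, ∑ b, v b * aeval y (pderiv b f) = 0 := fun f hf => by
      have := congrFun (LinearMap.mem_ker.mp hv) ⟨f, hf⟩
      simpa [gr, Matrix.mulVec, dotProduct, hy, mul_comm] using this
    have hsp : ∀ f ∈ Ideal.span (s : Set (MvPolynomial β ℂ)), aeval y f = 0 := fun f hf => by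
      rw [hs] at hf
      rw [hy, show aeval Φ f = 0 from hf, map_zero]
    -- Relations for finitely many generators of the ideal suffice: in the product rule for a
    -- multiple a f, the term containing the value of f vanishes.
    have hv2 : ∀ f : MvPolynomial β ℂ, aeval y f = 0 → ∑ b, v b * aeval y (pderiv b f) = 0 := by
      intro f hf
      have hf' : f ∈ Ideal.span (s : Set (MvPolynomial β ℂ)) := by
        rw [hs]; exact hinj (by rw [← hy, hf, map_zero])
      induction hf' using Submodule.span_induction with
      | mem f hfs => exact hv' f hfs
      | zero => simp
      | add f g hf0 hg0 h1 h2 =>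
        have hf1 : aeval y f = 0 := hsp f hf0
        have hg1 : aeval y g = 0 := hsp g hg0
        simp only [map_add, mul_add, Finset.sum_add_distrib, h1 hf1, h2 hg1, add_zero]
      | smul a f hf0 h1 =>
        have hf1 : aeval y f = 0 := hsp f hf0
        have h2 := h1 hf1
        simp only [smul_eq_mul, Derivation.leibniz, map_add, map_mul, hf1, zero_mul, add_zero]
        rw [Finset.sum_congr rfl fun b _ => mul_left_comm (v b) (aeval y a) _, ← Finset.mul_sum, h2,
          mul_zero]
    obtain ⟨D, hD⟩ := exists_derivation_of_relations y v hv2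
    refine ⟨fun j => D (algebraMap A F (X j)), ?_⟩
    have hsum : ∀ (E : ι → Derivation ℂ A F) (q : A), (∑ j, E j) q = ∑ j, E j q := fun E q =>
      (congrFun (map_sum Derivation.coeFnAddMonoidHom E Finset.univ) q).trans
        (Finset.sum_apply _ _ _)
    have hDe : D.compAlgebraMap A =
        ∑ j, D (algebraMap A F (X j)) • (Algebra.linearMap A F).compDer (pderiv j) := by
      apply derivation_ext
      intro i
      rw [hsum, Finset.sum_eq_single i]
      · change D _ = D _ * algebraMap A F (pderiv i (X i))
        rw [pderiv_X_self, map_one, mul_one]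
        rfl
      · intro j _ hj
        simp [pderiv_X_of_ne hj.symm]
      · simp
    ext b
    rw [← hD b]
    have := congrArg (fun E : Derivation ℂ A F => E (Φ b)) hDe
    simp only [hsum] at this
    simp only [J, Matrix.mulVecLin_apply, Matrix.mulVec, dotProduct, Matrix.of_apply]
    refine Eq.trans ?_ this.symm
    exact Finset.sum_congr rfl fun j _ => mul_comm _ _
  obtain ⟨B, C, hBC⟩ := exists_id_eq_add J gr hker
  let MB := LinearMap.toMatrix' B
  let MC := LinearMap.toMatrix' C
  obtain ⟨d, hd⟩ := IsLocalization.exist_integer_multiples_of_finite (nonZeroDivisors A)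
    (fun q : (ι × β) ⊕ (β × s) => Sum.elim (fun q => MB q.1 q.2) (fun q => MC q.1 q.2) q)
  choose N hN using hd
  have key : ∀ b b', (∑ j, pderiv j (Φ b) * N (.inl (j, b'))) +
      ∑ f : s, N (.inr (b, f)) * aeval Φ (pderiv b' f.1) = if b = b' then (d : A) else 0 := by
    intro b b'
    apply hinj
    have h1 := congrFun (congrArg (fun L => (d : A) • L (Pi.single b' 1)) hBC) b
    have hB : ∀ j, B (Pi.single b' 1) j = MB j b' := fun j => by
      simp [MB, LinearMap.toMatrix'_apply]
    have hC : ∀ v, C v = MC.mulVec v := fun v => (LinearMap.toMatrix'_mulVec C v).symm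
    have hg : ∀ f : s, gr (Pi.single b' 1) f = algebraMap A F (aeval Φ (pderiv b' f.1)) := by
      intro f; simp [gr]
    simp only [LinearMap.add_apply, LinearMap.comp_apply, LinearMap.id_apply, Pi.smul_apply,
      Pi.add_apply, hC] at h1
    simp only [J, Matrix.mulVecLin_apply, Matrix.mulVec, dotProduct, Matrix.of_apply, hB,
      hg, smul_add, Finset.smul_sum] at h1
    simp only [map_add, map_sum, map_mul, hN, Sum.elim_inl, Sum.elim_inr]
    rw [apply_ite (algebraMap A F), map_zero]
    convert! h1 using 1
    · congr 1
      · refine Finset.sum_congr rfl fun j _ => ?_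
        simp only [Algebra.smul_def]; ring
      · refine Finset.sum_congr rfl fun j _ => ?_
        simp only [Algebra.smul_def]; ring
    · rw [Pi.single_apply, Algebra.smul_def]
      split_ifs <;> simp
  refine ⟨d, nonZeroDivisors.coe_ne_zero d, fun w hw v hv => ?_⟩
  refine ⟨fun j => (eval w (d : A))⁻¹ * ∑ b', eval w (N (.inl (j, b'))) * v b', fun b => ?_⟩
  have h1 : ∑ b', v b' * eval w ((∑ j, pderiv j (Φ b) * N (.inl (j, b'))) +
      ∑ f : s, N (.inr (b, f)) * aeval Φ (pderiv b' f.1)) = v b * eval w (d : A) := by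
    simp only [key]
    rw [Finset.sum_eq_single b] <;> simp +contextual [eq_comm]
  have h2 : ∑ b', v b' * eval w (∑ f : s, N (.inr (b, f)) * aeval Φ (pderiv b' f.1)) = 0 := by
    simp only [map_sum, map_mul, Finset.mul_sum]
    rw [Finset.sum_comm]
    refine Finset.sum_eq_zero fun f _ => ?_
    have := hv f.1 (hsI f.1 f.2)
    rw [Finset.sum_congr rfl fun b' _ => mul_left_comm _ _ _, ← Finset.mul_sum, this, mul_zero]
  simp only [map_add, mul_add, Finset.sum_add_distrib, h2, add_zero] at h1
  rw [← mul_inv_cancel_right₀ hw (v b), ← h1]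
  simp only [map_sum, map_mul, Finset.mul_sum, Finset.sum_mul]
  rw [Finset.sum_comm]
  exact Finset.sum_congr rfl fun j _ => Finset.sum_congr rfl fun b' _ => by ring

/-! ### Polynomial functions, polynomial maps and Zariski density -/

namespace TensorData

/-- A polynomial function on a complex vector space: a polynomial in linear functionals. -/
def IsPolyFun {W : Type*} [AddCommGroup W] [Module ℂ W] (f : W → ℂ) : Prop :=
  ∃ P : MvPolynomial (Module.Dual ℂ W) ℂ, ∀ w, f w = MvPolynomial.eval (fun l => l w) P

/-- A polynomial map between complex vector spaces. -/
def IsPolyMap {W W' : Type*} [AddCommGroup W] [Module ℂ W] [AddCommGroup W'] [Module ℂ W']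
    (φ : W → W') : Prop :=
  ∀ l : Module.Dual ℂ W', IsPolyFun fun w => l (φ w)

section

variable {W W' W'' : Type*} [AddCommGroup W] [Module ℂ W] [AddCommGroup W'] [Module ℂ W']
  [AddCommGroup W''] [Module ℂ W'']

theorem isPolyFun_const (c : ℂ) : IsPolyFun fun _ : W => c :=
  ⟨MvPolynomial.C c, fun w => by simp⟩

theorem isPolyFun_linear (l : W →ₗ[ℂ] ℂ) : IsPolyFun fun w => l w :=
  ⟨MvPolynomial.X (l : Module.Dual ℂ W), fun w => by simp⟩

theorem IsPolyFun.add {f g : W → ℂ} (hf : IsPolyFun f) (hg : IsPolyFun g) :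
    IsPolyFun fun w => f w + g w := by
  obtain ⟨P, hP⟩ := hf
  obtain ⟨Q, hQ⟩ := hg
  exact ⟨P + Q, fun w => by simp [hP, hQ]⟩

theorem IsPolyFun.mul {f g : W → ℂ} (hf : IsPolyFun f) (hg : IsPolyFun g) :
    IsPolyFun fun w => f w * g w := by
  obtain ⟨P, hP⟩ := hf
  obtain ⟨Q, hQ⟩ := hg
  exact ⟨P * Q, fun w => by simp [hP, hQ]⟩

theorem IsPolyFun.sub {f g : W → ℂ} (hf : IsPolyFun f) (hg : IsPolyFun g) :
    IsPolyFun fun w => f w - g w := by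
  obtain ⟨P, hP⟩ := hf
  obtain ⟨Q, hQ⟩ := hg
  exact ⟨P - Q, fun w => by simp [hP, hQ]⟩

theorem IsPolyFun.sum {κ : Type*} (s : Finset κ) {f : κ → W → ℂ} (hf : ∀ k, IsPolyFun (f k)) :
    IsPolyFun fun w => ∑ k ∈ s, f k w := by
  choose P hP using hf
  exact ⟨∑ k ∈ s, P k, fun w => by simp [hP]⟩

theorem IsPolyFun.prod {κ : Type*} (s : Finset κ) {f : κ → W → ℂ} (hf : ∀ k, IsPolyFun (f k)) :
    IsPolyFun fun w => ∏ k ∈ s, f k w := by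
  choose P hP using hf
  exact ⟨∏ k ∈ s, P k, fun w => by simp [hP]⟩

theorem IsPolyFun.pow {f : W → ℂ} (hf : IsPolyFun f) (k : ℕ) : IsPolyFun fun w => f w ^ k := by
  obtain ⟨P, hP⟩ := hf
  exact ⟨P ^ k, fun w => by simp [hP]⟩

theorem IsPolyFun.eval {κ : Type*} {φ : W → κ → ℂ} (h : ∀ k, IsPolyFun fun w => φ w k)
    (P : MvPolynomial κ ℂ) : IsPolyFun fun w => MvPolynomial.eval (φ w) P := by
  choose Q hQ using h
  refine ⟨MvPolynomial.aeval Q P, fun w => ?_⟩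
  induction P using MvPolynomial.induction_on with
  | C a => simp
  | add p q hp hq => simp [hp, hq]
  | mul_X p k hp => simp [hp, hQ]

theorem IsPolyFun.comp {f : W' → ℂ} (hf : IsPolyFun f) {φ : W → W'} (hφ : IsPolyMap φ) :
    IsPolyFun fun w => f (φ w) := by
  obtain ⟨P, hP⟩ := hf
  simp only [hP]
  exact IsPolyFun.eval (φ := fun w (l : Module.Dual ℂ W') => l (φ w)) hφ P

theorem IsPolyMap.comp {ψ : W' → W''} (hψ : IsPolyMap ψ) {φ : W → W'} (hφ : IsPolyMap φ) :
    IsPolyMap fun w => ψ (φ w) :=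
  fun l => (hψ l).comp hφ

theorem isPolyMap_linear (φ : W →ₗ[ℂ] W') : IsPolyMap fun w => φ w :=
  fun l => isPolyFun_linear (l ∘ₗ φ)

theorem isPolyMap_id : IsPolyMap fun w : W => w :=
  isPolyMap_linear LinearMap.id

theorem isPolyMap_fst : IsPolyMap fun q : W × W' => q.1 :=
  isPolyMap_linear (LinearMap.fst ℂ W W')

theorem isPolyMap_snd : IsPolyMap fun q : W × W' => q.2 :=
  isPolyMap_linear (LinearMap.snd ℂ W W')

theorem isPolyMap_const (c : W') : IsPolyMap fun _ : W => c :=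
  fun l => isPolyFun_const (l c)

theorem IsPolyMap.prodMk {φ : W → W'} {ψ : W → W''} (hφ : IsPolyMap φ) (hψ : IsPolyMap ψ) :
    IsPolyMap fun w => (φ w, ψ w) := by
  intro l
  have : (fun w => l (φ w, ψ w)) =
      fun w => (l ∘ₗ LinearMap.inl ℂ W' W'') (φ w) + (l ∘ₗ LinearMap.inr ℂ W' W'') (ψ w) := by
    funext w
    simp [← map_add]
  rw [this]
  exact (hφ _).add (hψ _)

theorem IsPolyMap.add {φ ψ : W → W'} (hφ : IsPolyMap φ) (hψ : IsPolyMap ψ) :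
    IsPolyMap fun w => φ w + ψ w := by
  intro l
  simp only [map_add]
  exact (hφ l).add (hψ l)

theorem IsPolyMap.smul {f : W → ℂ} {φ : W → W'} (hf : IsPolyFun f) (hφ : IsPolyMap φ) :
    IsPolyMap fun w => f w • φ w := by
  intro l
  simp only [map_smul, smul_eq_mul]
  exact hf.mul (hφ l)

theorem isPolyMap_pi {κ : Type*} [Fintype κ] {φ : W → κ → ℂ}
    (h : ∀ k, IsPolyFun fun w => φ w k) : IsPolyMap φ := by
  classical
  intro l
  have : (fun w => l (φ w)) = fun w => ∑ k, l (Pi.single k 1) * φ w k := by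
    funext w
    conv_lhs => rw [pi_eq_sum_univ' (φ w)]
    simp [mul_comm]
  rw [this]
  exact .sum _ fun k => (isPolyFun_const _).mul (h k)

theorem IsPolyMap.apply {κ : Type*} {φ : W → κ → ℂ} (h : IsPolyMap φ) (k : κ) :
    IsPolyFun fun w => φ w k :=
  h (LinearMap.proj k)

theorem isPolyFun_apply {κ : Type*} (k : κ) : IsPolyFun fun w : κ → ℂ => w k :=
  isPolyFun_linear (LinearMap.proj (R := ℂ) (φ := fun _ : κ => ℂ) k)

theorem IsPolyFun.exists_eval {κ : Type*} [Fintype κ] {f : (κ → ℂ) → ℂ} (hf : IsPolyFun f) :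
    ∃ P : MvPolynomial κ ℂ, ∀ w, f w = MvPolynomial.eval w P := by
  classical
  obtain ⟨P, hP⟩ := hf
  refine ⟨MvPolynomial.aeval (fun l : Module.Dual ℂ (κ → ℂ) =>
    ∑ k, MvPolynomial.C (l (Pi.single k 1)) * MvPolynomial.X k) P, fun w => ?_⟩
  have h : ∀ l : Module.Dual ℂ (κ → ℂ), l w = ∑ k, l (Pi.single k 1) * w k := fun l => by
    conv_lhs => rw [pi_eq_sum_univ' w]
    simp [mul_comm]
  rw [hP]
  clear hP
  induction P using MvPolynomial.induction_on with
  | C a => simp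
  | add p q hp hq => simp [hp, hq]
  | mul_X p k hp => simp [hp, ← h]

theorem isPolyFun_eval {κ : Type*} (P : MvPolynomial κ ℂ) :
    IsPolyFun fun w => MvPolynomial.eval w P :=
  IsPolyFun.eval (φ := fun w => w) isPolyFun_apply P

/-! ### Zariski closures -/

theorem mem_zariskiClosure {S : Set W} {w : W} :
    w ∈ zariskiClosure S ↔ ∀ f, IsPolyFun f → (∀ s ∈ S, f s = 0) → f w = 0 := by
  constructor
  · rintro h f ⟨P, hP⟩ hf
    rw [hP]
    exact h P fun s hs => (hP s).symm.trans (hf s hs)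
  · exact fun h P hP => h _ ⟨P, fun _ => rfl⟩ hP

theorem subset_zariskiClosure (S : Set W) : S ⊆ zariskiClosure S :=
  fun _ hw _ hP => hP _ hw

theorem mem_zariskiClosure_of_maps {S : Set W} {T : Set W'} {φ : W → W'} (hφ : IsPolyMap φ)
    (h : ∀ s ∈ S, φ s ∈ zariskiClosure T) {w : W} (hw : w ∈ zariskiClosure S) :
    φ w ∈ zariskiClosure T := by
  rw [mem_zariskiClosure] at hw ⊢
  exact fun f hf hT => hw _ (hf.comp hφ) fun s hs => mem_zariskiClosure.mp (h s hs) f hf hT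

theorem zariskiClosure_minimal {S T : Set W} (h : S ⊆ zariskiClosure T) :
    zariskiClosure S ⊆ zariskiClosure T :=
  fun _ hw => mem_zariskiClosure_of_maps isPolyMap_id (fun _ hs => h hs) hw

theorem zariskiClosure_mono {S T : Set W} (h : S ⊆ T) : zariskiClosure S ⊆ zariskiClosure T :=
  zariskiClosure_minimal (h.trans (subset_zariskiClosure T))

theorem zariskiClosure_nonempty_of_subsingleton [Subsingleton W] {S : Set W} (hS : S.Nonempty)
    (w : W) : w ∈ zariskiClosure S := by
  obtain ⟨s, hs⟩ := hS
  rw [Subsingleton.elim w s]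
  exact subset_zariskiClosure S hs

/-! ### Euclidean open sets are Zariski dense -/

theorem eq_zero_of_eval_eq_zero_of_isOpen {ι : Type*} [Fintype ι] {U : Set (ι → ℂ)}
    (hU : IsOpen U) (hne : U.Nonempty) {P : MvPolynomial ι ℂ}
    (h : ∀ w ∈ U, MvPolynomial.eval w P = 0) : P = 0 := by
  obtain ⟨w, hw⟩ := hne
  obtain ⟨ε, hε, hball⟩ := Metric.isOpen_iff.mp hU w hw
  refine MvPolynomial.funext_set (fun i => Metric.ball (w i) ε) (fun i => ?_) fun x hx => ?_
  · exact infinite_of_mem_nhds (w i) (Metric.ball_mem_nhds _ hε)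
  · rw [map_zero]
    refine h x (hball ?_)
    rw [← ball_pi _ hε] at *
    exact hx

theorem mem_zariskiClosure_of_isOpen {ι : Type*} [Fintype ι] {U : Set (ι → ℂ)}
    (hU : IsOpen U) (hne : U.Nonempty) (w : ι → ℂ) : w ∈ zariskiClosure U := by
  rw [mem_zariskiClosure]
  intro f hf h
  obtain ⟨P, hP⟩ := hf.exists_eval
  rw [hP, eq_zero_of_eval_eq_zero_of_isOpen hU hne fun w hw => (hP w).symm.trans (h w hw), map_zero]

theorem isOpen_eval_ne_zero {ι : Type*} [Fintype ι] (P : MvPolynomial ι ℂ) :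
    IsOpen {w : ι → ℂ | MvPolynomial.eval w P ≠ 0} :=
  isOpen_ne_fun (MvPolynomial.continuous_eval P) continuous_const

theorem exists_eval_ne_zero_of_isOpen {ι : Type*} [Fintype ι] {U : Set (ι → ℂ)}
    (hU : IsOpen U) (hne : U.Nonempty) {P : MvPolynomial ι ℂ} (hP : P ≠ 0) :
    ∃ w ∈ U, MvPolynomial.eval w P ≠ 0 := by
  by_contra! h
  exact hP (eq_zero_of_eval_eq_zero_of_isOpen hU hne h)

/-! ### Derivatives of polynomials -/

theorem hasFDerivAt_eval {ι : Type*} [Fintype ι] (P : MvPolynomial ι ℂ) (z : ι → ℂ) :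
    HasFDerivAt (fun w => MvPolynomial.eval w P) (differentialAt P z).toContinuousLinearMap z := by
  induction P using MvPolynomial.induction_on with
  | C a =>
    convert! hasFDerivAt_const (𝕜 := ℂ) a z using 1
    · simp
    · ext; simp [differentialAt]
  | add p q hp hq =>
    convert! hp.add hq using 1
    · ext; simp
    · ext; simp [differentialAt, add_mul, Finset.sum_add_distrib]
  | mul_X p k hp =>
    classical
    convert! hp.mul (hasFDerivAt_apply (𝕜 := ℂ) k z) using 1
    · ext; simp
    · ext v
      simp [differentialAt, Derivation.leibniz, add_mul, Finset.sum_add_distrib,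
        MvPolynomial.pderiv_X, Pi.single_apply, apply_ite, Finset.mul_sum]
      simp only [mul_assoc]

theorem IsPolyFun.differentiable {ι : Type*} [Fintype ι] {f : (ι → ℂ) → ℂ} (hf : IsPolyFun f) :
    Differentiable ℂ f := by
  obtain ⟨P, hP⟩ := hf.exists_eval
  rw [funext hP]
  exact fun z => (hasFDerivAt_eval P z).differentiableAt

end

end TensorData

/-! ### Tangent spaces, generic smoothness and the tensor formalism -/

namespace TensorData

section

variable {ι β : Type} [Fintype ι] [Fintype β]

theorem differentialAt_apply (f : MvPolynomial β ℂ) (z v : β → ℂ) :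
    differentialAt f z v = ∑ b, MvPolynomial.eval z (MvPolynomial.pderiv b f) * v b := by
  simp [differentialAt, LinearMap.sum_apply]

theorem mem_tangentSpace {Z : Set (β → ℂ)} {z v : β → ℂ} :
    v ∈ tangentSpace Z z ↔ ∀ f : MvPolynomial β ℂ, (∀ w ∈ Z, MvPolynomial.eval w f = 0) →
      differentialAt f z v = 0 := by
  simp [tangentSpace, Submodule.mem_iInf]

/-- A functional that vanishes on the tangent space is the differential of an equation. -/
theorem exists_differentialAt_eq {Z : Set (β → ℂ)} {z : β → ℂ} (l : (β → ℂ) →ₗ[ℂ] ℂ)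
    (h : ∀ v ∈ tangentSpace Z z, l v = 0) :
    ∃ f : MvPolynomial β ℂ, (∀ w ∈ Z, MvPolynomial.eval w f = 0) ∧ differentialAt f z = l := by
  let δ : MvPolynomial β ℂ →ₗ[ℂ] Module.Dual ℂ (β → ℂ) :=
    { toFun := fun f => differentialAt f z
      map_add' := fun f g => LinearMap.ext fun v => by
        simp [differentialAt_apply, add_mul, Finset.sum_add_distrib]
      map_smul' := fun c f => LinearMap.ext fun v => by
        simp [differentialAt_apply, Finset.mul_sum, mul_assoc] }
  let I : Submodule ℂ (MvPolynomial β ℂ) :=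
    { carrier := {f | ∀ w ∈ Z, MvPolynomial.eval w f = 0}
      add_mem' := fun hf hg w hw => by rw [map_add, hf w hw, hg w hw, add_zero]
      zero_mem' := fun w _ => map_zero _
      smul_mem' := fun c f hf w hw => by rw [MvPolynomial.smul_eval, hf w hw, mul_zero] }
  have hl : l ∈ (I.map δ).dualCoannihilator.dualAnnihilator := by
    rw [Submodule.mem_dualAnnihilator]
    intro v hv
    refine h v (mem_tangentSpace.mpr fun f hf => ?_)
    exact (Submodule.mem_dualCoannihilator _).mp hv _ (Submodule.mem_map_of_mem (f := δ) hf)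
  rw [Subspace.dualCoannihilator_dualAnnihilator_eq] at hl
  obtain ⟨f, hf, rfl⟩ := hl
  exact ⟨f, hf, rfl⟩

theorem mem_tangentSpace_of_hasDerivAt {Z : Set (β → ℂ)} {γ : ℂ → β → ℂ} {v : β → ℂ} {t : ℂ}
    (hγ : HasDerivAt γ v t) (h : ∀ ε, γ ε ∈ Z) : v ∈ tangentSpace Z (γ t) := by
  rw [mem_tangentSpace]
  intro f hf
  have h1 := (hasFDerivAt_eval f (γ t)).comp_hasDerivAt t hγ
  have h2 : HasDerivAt (fun ε => MvPolynomial.eval (γ ε) f) 0 t := by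
    simp only [fun ε => hf _ (h ε)]
    exact hasDerivAt_const t 0
  exact h1.unique h2

/-- Semicontinuity of the Jacobian rank. Equations whose differentials at z₀ form a dual basis on a
complement q of the tangent space have a determinant on q that is nonzero at z₀. Where it is
nonzero, the tangent space still meets q only in zero. -/
theorem generic_finrank_tangentSpace_le {φ : (ι → ℂ) → β → ℂ} (hφ : IsPolyMap φ) {z₀ : β → ℂ}
    (hz : z₀ ∈ zariskiClosure (Set.range φ)) :
    ∃ g : MvPolynomial ι ℂ, g ≠ 0 ∧ ∀ w, MvPolynomial.eval w g ≠ 0 →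
      Module.finrank ℂ (tangentSpace (zariskiClosure (Set.range φ)) (φ w)) ≤
        Module.finrank ℂ (tangentSpace (zariskiClosure (Set.range φ)) z₀) := by
  classical
  set Z := zariskiClosure (Set.range φ) with hZ
  obtain ⟨q, hq⟩ := (tangentSpace Z z₀).exists_isCompl
  let e := Module.finBasis ℂ q
  have hf : ∀ i, ∃ f : MvPolynomial β ℂ, (∀ w ∈ Z, MvPolynomial.eval w f = 0) ∧
      differentialAt f z₀ = (e.coord i) ∘ₗ q.projectionOnto _ hq.symm := fun i => by
    refine exists_differentialAt_eq _ fun v hv => ?_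
    rw [LinearMap.comp_apply, (Submodule.projectionOnto_apply_eq_zero_iff hq.symm).mpr hv, map_zero]
  choose f hfZ hfd using hf
  let M : (β → ℂ) → Matrix _ _ ℂ := fun z => Matrix.of fun i k => differentialAt (f i) z (e k)
  have hM0 : M z₀ = 1 := by
    ext i k
    simp [M, hfd, Matrix.one_apply, Finsupp.single_apply, eq_comm]
  have hpoly : IsPolyFun fun z => (M z).det := by
    simp only [Matrix.det_apply', M, Matrix.of_apply, differentialAt_apply]
    exact .sum _ fun σ => (isPolyFun_const _).mul <| .prod _ fun i => .sum _ fun b =>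
      (isPolyFun_eval _).mul (isPolyFun_const _)
  obtain ⟨g, hg⟩ := (hpoly.comp hφ).exists_eval
  refine ⟨g, ?_, fun w hw => ?_⟩
  · rintro rfl
    -- z₀ is in the closure of the image, so a determinant vanishing on the image would vanish at
    -- z₀, where `M` is the identity.
    have h1 : (M z₀).det = 0 := mem_zariskiClosure.mp hz _ hpoly (by
      rintro _ ⟨w, rfl⟩
      rw [hg, map_zero])
    rw [hM0, Matrix.det_one] at h1
    exact one_ne_zero h1
  · have hdisj : Disjoint (tangentSpace Z (φ w)) q := by
      rw [Submodule.disjoint_def]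
      intro v hv hvq
      have h1 : (M (φ w)).mulVec (e.repr ⟨v, hvq⟩) = 0 := by
        funext i
        have h2 := mem_tangentSpace.mp hv (f i) (hfZ i)
        have h3 : v = ∑ k, e.repr ⟨v, hvq⟩ k • (e k : β → ℂ) := by
          have := congrArg q.subtype (e.sum_repr ⟨v, hvq⟩)
          rw [map_sum] at this
          exact this.symm
        rw [h3, map_sum] at h2
        simpa [M, Matrix.mulVec, dotProduct, mul_comm] using h2
      have h4 := Matrix.eq_zero_of_mulVec_eq_zero (by rw [hg]; exact hw) h1
      have h5 : (⟨v, hvq⟩ : q) = 0 := e.repr.map_eq_zero_iff.mp (Finsupp.ext fun k => congrFun h4 k)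
      exact congrArg Subtype.val h5
    have h1 := Submodule.finrank_add_finrank_le_of_disjoint hdisj
    have h2 := Submodule.finrank_add_eq_of_isCompl hq
    omega

/-- Generic smoothness: at the image of a general parameter, the closure of the image of a
polynomial map is regular, and its tangent vectors are derivatives of the parametrization. -/
theorem generic_smoothness {φ : (ι → ℂ) → β → ℂ} (hφ : IsPolyMap φ) :
    ∃ g : MvPolynomial ι ℂ, g ≠ 0 ∧ ∀ w, MvPolynomial.eval w g ≠ 0 →
      φ w ∈ regularLocus (zariskiClosure (Set.range φ)) ∧
      ∀ v ∈ tangentSpace (zariskiClosure (Set.range φ)) (φ w),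
        ∃ u : ι → ℂ, HasDerivAt (fun ε : ℂ => φ (w + ε • u)) v 0 := by
  classical
  choose Φ hΦ using fun b => (hφ.apply b).exists_eval
  obtain ⟨g₁, hg₁, h₁⟩ := generic_tangent_eq_range Φ
  have hne : (zariskiClosure (Set.range φ)).Nonempty :=
    ⟨φ 0, subset_zariskiClosure _ ⟨0, rfl⟩⟩
  obtain ⟨z₀, hz₀, hmin⟩ := (measure fun z =>
    Module.finrank ℂ (tangentSpace (zariskiClosure (Set.range φ)) z)).wf.has_min _ hne
  obtain ⟨g₂, hg₂, h₂⟩ := generic_finrank_tangentSpace_le hφ hz₀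
  refine ⟨g₁ * g₂, mul_ne_zero hg₁ hg₂, fun w hw => ?_⟩
  rw [map_mul] at hw
  refine ⟨⟨subset_zariskiClosure _ ⟨w, rfl⟩, fun z hz => ?_⟩, fun v hv => ?_⟩
  · exact (h₂ w (right_ne_zero_of_mul hw)).trans (not_lt.mp (hmin z hz))
  · have hev : ∀ (f : MvPolynomial β ℂ) w, MvPolynomial.eval w (MvPolynomial.aeval Φ f) =
        MvPolynomial.eval (φ w) f := fun f w => by
      rw [show φ w = fun b => MvPolynomial.eval w (Φ b) from funext fun b => hΦ b w]
      induction f using MvPolynomial.induction_on with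
      | C a => simp
      | add p q hp hq => rw [map_add, map_add, map_add, hp, hq]
      | mul_X p k hp =>
        rw [map_mul, map_mul, map_mul, hp, MvPolynomial.aeval_X, MvPolynomial.eval_X]
    obtain ⟨u, hu⟩ := h₁ w (left_ne_zero_of_mul hw) v fun f hf => by
      have hfZ : ∀ z ∈ zariskiClosure (Set.range φ), MvPolynomial.eval z f = 0 := fun z hz =>
        mem_zariskiClosure.mp hz _ (isPolyFun_eval f) (by
          rintro _ ⟨w, rfl⟩
          rw [← hev, hf, map_zero])
      have := mem_tangentSpace.mp hv f hfZ
      rw [differentialAt_apply] at this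
      simpa only [hev, mul_comm] using this
    refine ⟨u, hasDerivAt_pi.mpr fun b => ?_⟩
    have hline : HasDerivAt (fun ε : ℂ => w + ε • u) u 0 := by
      simpa using ((hasDerivAt_id (0 : ℂ)).smul_const u).const_add w
    have h3 : HasFDerivAt (fun w => MvPolynomial.eval w (Φ b))
        (differentialAt (Φ b) w).toContinuousLinearMap (w + (0 : ℂ) • u) := by
      simpa using hasFDerivAt_eval (Φ b) w
    have h4 := h3.comp_hasDerivAt (0 : ℂ) hline
    simp only [hΦ]
    convert! h4 using 1
    rw [hu b]
    simp [differentialAt_apply, mul_comm]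

end

section

variable {p : ℕ} {n : Fin p → ℕ}

/-! ### The action of matrices on tensors -/

/-- The action of a tuple of square matrices on tensors. -/
noncomputable def act (g : (i : Fin p) → Matrix (Fin (n i)) (Fin (n i)) ℂ) :
    Tensor n →ₗ[ℂ] Tensor n where
  toFun T b := ∑ a, (∏ i, g i (b i) (a i)) * T a
  map_add' S T := by
    funext b
    simp [mul_add, Finset.sum_add_distrib]
  map_smul' c T := by
    funext b
    simp [Finset.mul_sum, mul_left_comm]

theorem act_apply (g : (i : Fin p) → Matrix (Fin (n i)) (Fin (n i)) ℂ) (T : Tensor n)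
    (b : (i : Fin p) → Fin (n i)) : act g T b = ∑ a, (∏ i, g i (b i) (a i)) * T a :=
  rfl

theorem sum_prod_mul_outer (f x : (i : Fin p) → Fin (n i) → ℂ) :
    ∑ a, (∏ i, f i (a i)) * outer x a = ∏ i, ∑ c, f i c * x i c := by
  classical
  simp only [outer, ← Finset.prod_mul_distrib]
  rw [Finset.prod_univ_sum, Fintype.piFinset_univ]

theorem act_outer (g : (i : Fin p) → Matrix (Fin (n i)) (Fin (n i)) ℂ)
    (x : (i : Fin p) → Fin (n i) → ℂ) :
    act g (outer x) = outer fun i => (g i).mulVec (x i) :=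
  funext fun b => sum_prod_mul_outer (fun i => g i (b i)) x

theorem act_act (g h : (i : Fin p) → Matrix (Fin (n i)) (Fin (n i)) ℂ) (T : Tensor n) :
    act g (act h T) = act (fun i => g i * h i) T := by
  funext b
  simp only [act_apply, Finset.mul_sum]
  rw [Finset.sum_comm]
  refine Finset.sum_congr rfl fun a _ => ?_
  have := sum_prod_mul_outer (fun i => g i (b i)) (fun i c => h i c (a i))
  simp only [outer] at this
  simp only [← mul_assoc, ← Finset.sum_mul, this, Matrix.mul_apply]

theorem act_one (T : Tensor n) : act (fun _ => 1) T = T := by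
  classical
  funext b
  rw [act_apply, Finset.sum_eq_single b]
  · simp
  · intro a _ hab
    obtain ⟨i, hi⟩ := Function.ne_iff.mp hab
    have h1 : (1 : Matrix (Fin (n i)) (Fin (n i)) ℂ) (b i) (a i) = 0 :=
      Matrix.one_apply_ne hi.symm
    rw [Finset.prod_eq_zero (Finset.mem_univ i) h1, zero_mul]
  · simp

theorem act_mem_rankOne (g : (i : Fin p) → Matrix (Fin (n i)) (Fin (n i)) ℂ) {T : Tensor n}
    (hT : T ∈ rankOne n) : act g T ∈ rankOne n := by
  obtain ⟨x, rfl⟩ := hT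
  exact ⟨_, (act_outer g x).symm⟩

theorem sum_mul_act (g : (i : Fin p) → Matrix (Fin (n i)) (Fin (n i)) ℂ) (S T : Tensor n) :
    ∑ b, S b * act g T b = ∑ a, act (fun i => (g i).transpose) S a * T a := by
  simp only [act_apply, Finset.mul_sum, Finset.sum_mul, Matrix.transpose_apply]
  rw [Finset.sum_comm]
  exact Finset.sum_congr rfl fun a _ => Finset.sum_congr rfl fun b _ => by ring

theorem act_update_one (i : Fin p) (E : Matrix (Fin (n i)) (Fin (n i)) ℂ) (T : Tensor n)
    (b : (i : Fin p) → Fin (n i)) :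
    act (Function.update (fun _ => 1) i E) T b = ∑ c, E (b i) c * T (Function.update b i c) := by
  classical
  rw [act_apply]
  refine (Finset.sum_of_injOn (fun c => Function.update b i c) ?_ ?_ ?_ ?_).symm
  · exact (Function.update_injective b i).injOn
  · simp
  · intro a _ ha
    have : ∃ l, l ≠ i ∧ a l ≠ b l := by
      by_contra! h
      refine ha ⟨a i, Finset.mem_coe.mpr (Finset.mem_univ _), ?_⟩
      funext l
      by_cases hl : l = i
      · subst hl; simp
      · simp [hl, h l hl]
    obtain ⟨l, hl, hab⟩ := this
    rw [Finset.prod_eq_zero (Finset.mem_univ l), zero_mul]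
    rw [Function.update_of_ne hl, Matrix.one_apply_ne hab.symm]
  · intro c _
    congr 1
    rw [Finset.prod_eq_single i]
    · simp
    · intro l _ hl
      simp [hl]
    · simp

/-! ### Decomposable tensors -/

theorem outer_update_add (x : (i : Fin p) → Fin (n i) → ℂ) (i : Fin p) (u v : Fin (n i) → ℂ) :
    outer (Function.update x i (u + v)) =
      outer (Function.update x i u) + outer (Function.update x i v) := by
  funext a
  simp only [outer, Pi.add_apply, ← Finset.mul_prod_erase _ _ (Finset.mem_univ i),
    Function.update_self, add_mul]
  congr 2 <;> exact Finset.prod_congr rfl fun l hl => by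
    rw [Function.update_of_ne (Finset.ne_of_mem_erase hl),
      Function.update_of_ne (Finset.ne_of_mem_erase hl)]

theorem outer_update_smul (x : (i : Fin p) → Fin (n i) → ℂ) (i : Fin p) (c : ℂ)
    (u : Fin (n i) → ℂ) :
    outer (Function.update x i (c • u)) = c • outer (Function.update x i u) := by
  funext a
  simp only [outer, Pi.smul_apply, smul_eq_mul, ← Finset.mul_prod_erase _ _ (Finset.mem_univ i),
    Function.update_self, mul_assoc]
  congr 2
  exact Finset.prod_congr rfl fun l hl => by
    rw [Function.update_of_ne (Finset.ne_of_mem_erase hl),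
      Function.update_of_ne (Finset.ne_of_mem_erase hl)]

theorem outer_eq_zero {x : (i : Fin p) → Fin (n i) → ℂ} {i : Fin p} (hi : x i = 0) :
    outer x = 0 := by
  funext a
  exact Finset.prod_eq_zero (Finset.mem_univ i) (by rw [hi, Pi.zero_apply])

theorem outer_smul (c : Fin p → ℂ) (x : (i : Fin p) → Fin (n i) → ℂ) :
    outer (fun i => c i • x i) = (∏ i, c i) • outer x := by
  funext a
  simp [outer, Finset.prod_mul_distrib]

theorem single_eq_outer [DecidableEq ((i : Fin p) → Fin (n i))] (a : (i : Fin p) → Fin (n i)) :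
    (Pi.single a 1 : Tensor n) = outer fun i => Pi.single (a i) 1 := by
  funext b
  simp only [outer]
  by_cases hb : b = a
  · subst hb; simp
  · obtain ⟨i, hi⟩ := Function.ne_iff.mp hb
    rw [Pi.single_eq_of_ne hb, Finset.prod_eq_zero (Finset.mem_univ i)]
    rw [Pi.single_eq_of_ne hi]

theorem smul_mem_rankOne (hp : 0 < p) (c : ℂ) {T : Tensor n} (hT : T ∈ rankOne n) :
    c • T ∈ rankOne n := by
  obtain ⟨x, rfl⟩ := hT
  refine ⟨Function.update x ⟨0, hp⟩ (c • x ⟨0, hp⟩), ?_⟩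
  rw [outer_update_smul, Function.update_eq_self]

theorem zero_mem_rankOne (hp : 0 < p) : (0 : Tensor n) ∈ rankOne n :=
  ⟨0, outer_eq_zero (i := ⟨0, hp⟩) rfl⟩

/-- The variety of tensors of rank at most one is Zariski closed. -/
theorem zariskiClosure_rankOne_subset (hp : 0 < p) :
    zariskiClosure (rankOne n) ⊆ rankOne n := by
  classical
  intro T hT
  -- These polynomial equations hold on X, hence on its closure. If T b ≠ 0 they exhibit T as a
  -- scalar multiple of the product of its fibres through b.
  have key : ∀ a b, T a * T b ^ (p - 1) = ∏ i, T (Function.update b i (a i)) := by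
    intro a b
    have hpoly : IsPolyFun fun T : Tensor n =>
        T a * T b ^ (p - 1) - ∏ i, T (Function.update b i (a i)) :=
      ((isPolyFun_apply a).mul ((isPolyFun_apply b).pow _)).sub
        (.prod _ fun i => isPolyFun_apply _)
    refine sub_eq_zero.mp (mem_zariskiClosure.mp hT _ hpoly ?_)
    rintro _ ⟨x, rfl⟩
    have h1 : ∀ i, outer x (Function.update b i (a i)) =
        x i (a i) * ∏ l ∈ Finset.univ.erase i, x l (b l) := fun i => by
      rw [outer, ← Finset.mul_prod_erase _ _ (Finset.mem_univ i), Function.update_self]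
      congr 1
      exact Finset.prod_congr rfl fun l hl => by
        rw [Function.update_of_ne (Finset.ne_of_mem_erase hl)]
    simp only [h1, Finset.prod_mul_distrib]
    rw [sub_eq_zero, outer, outer, ← Finset.prod_pow]
    congr 1
    rw [Finset.prod_comm' (t' := Finset.univ) (s' := fun l => Finset.univ.erase l)
      (by intro x y; simp [eq_comm])]
    simp
  by_cases h0 : T = 0
  · rw [h0]; exact zero_mem_rankOne hp
  obtain ⟨b, hb⟩ := Function.ne_iff.mp h0
  have hbne : T b ^ (p - 1) ≠ 0 := pow_ne_zero _ hb
  have : T = (T b ^ (p - 1))⁻¹ • outer fun i c => T (Function.update b i c) := by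
    funext a
    rw [Pi.smul_apply, smul_eq_mul, outer, ← key, mul_comm (T a), inv_mul_cancel_left₀ hbne]
  rw [this]
  exact smul_mem_rankOne hp _ ⟨_, rfl⟩

/-! ### The Bombieri-Weyl form -/

/-- The complexification of a tuple of Gram matrices. -/
noncomputable def gram (G : (i : Fin p) → Matrix (Fin (n i)) (Fin (n i)) ℝ) (i : Fin p) :
    Matrix (Fin (n i)) (Fin (n i)) ℂ :=
  (G i).map Complex.ofReal

variable (G : (i : Fin p) → Matrix (Fin (n i)) (Fin (n i)) ℝ)

theorem bombieriWeyl_eq (S T : Tensor n) :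
    bombieriWeyl G S T = ∑ b, S b * act (gram G) T b := by
  simp only [bombieriWeyl, act_apply, Finset.mul_sum, gram, Matrix.map_apply]
  exact Finset.sum_congr rfl fun a _ => Finset.sum_congr rfl fun b _ => by ring

variable {G} (hG : ∀ i, (G i).PosDef)

include hG in
theorem gram_transpose (i : Fin p) : (gram G i).transpose = gram G i := by
  have h := (hG i).1
  ext a b
  have := congrFun (congrFun h a) b
  simp only [Matrix.conjTranspose_apply, star_trivial] at this
  simp [gram, this]

include hG in
theorem isUnit_det_gram (i : Fin p) : IsUnit (gram G i).det := by
  have h : (gram G i).det = ((G i).det : ℂ) := (RingHom.map_det Complex.ofRealHom (G i)).symm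
  rw [h, isUnit_iff_ne_zero, Complex.ofReal_ne_zero]
  exact (hG i).det_pos.ne'

include hG in
theorem bombieriWeyl_comm (S T : Tensor n) : bombieriWeyl G S T = bombieriWeyl G T S := by
  rw [bombieriWeyl_eq, bombieriWeyl_eq, sum_mul_act]
  simp only [gram_transpose hG]
  exact Finset.sum_congr rfl fun a _ => mul_comm _ _

include hG in
theorem complexForm_comm (i : Fin p) (x y : Fin (n i) → ℂ) :
    complexForm (G i) x y = complexForm (G i) y x := by
  have h := (hG i).1
  simp only [complexForm]
  rw [Finset.sum_comm]
  refine Finset.sum_congr rfl fun a _ => Finset.sum_congr rfl fun b _ => ?_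
  have := congrFun (congrFun h a) b
  simp only [Matrix.conjTranspose_apply, star_trivial] at this
  rw [this]
  ring

include hG in
theorem act_inv_act_gram (T : Tensor n) :
    act (fun i => (gram G i)⁻¹) (act (gram G) T) = T := by
  rw [act_act]
  conv_rhs => rw [← act_one T]
  congr 2
  funext i
  exact Matrix.nonsing_inv_mul _ (isUnit_det_gram hG i)

include hG in
theorem eq_zero_of_bombieriWeyl {T : Tensor n} (h : ∀ S, bombieriWeyl G S T = 0) : T = 0 := by
  classical
  rw [← act_inv_act_gram hG T]
  have : act (gram G) T = 0 := by
    funext b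
    have := h (Pi.single b 1)
    rw [bombieriWeyl_eq] at this
    simpa [Pi.single_apply] using this
  rw [this, map_zero]

theorem bombieriWeyl_outer_act (x : (i : Fin p) → Fin (n i) → ℂ)
    (k : (i : Fin p) → Matrix (Fin (n i)) (Fin (n i)) ℂ) (T : Tensor n) :
    bombieriWeyl G (outer x) (act k T) =
      ∑ a, (∏ i, Matrix.vecMul (x i) (gram G i * k i) (a i)) * T a := by
  rw [bombieriWeyl_eq, act_act, sum_mul_act, act_outer]
  simp only [Matrix.mulVec_transpose, outer]

theorem hasDerivAt_bombieriWeyl_left {γ : ℂ → Tensor n} {v : Tensor n} {t : ℂ}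
    (hγ : HasDerivAt γ v t) (T : Tensor n) :
    HasDerivAt (fun ε => bombieriWeyl G (γ ε) T) (bombieriWeyl G v T) t := by
  simp only [bombieriWeyl_eq]
  exact HasDerivAt.fun_sum fun b _ => ((hasDerivAt_pi.mp hγ) b).mul_const _

end

section

variable {p : ℕ} {n : Fin p → ℕ}

/-! ### A polynomial parametrization of the conormal variety -/

/-- The index `a` differs from `a₀` in at least two positions. -/
def IsFar (a₀ a : (i : Fin p) → Fin (n i)) : Prop :=
  ∃ i j, i ≠ j ∧ a i ≠ a₀ i ∧ a j ≠ a₀ j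

open Classical in
/-- The part of a tensor supported on the indices that differ from `a₀` in at least two
positions. -/
noncomputable def farPart (a₀ : (i : Fin p) → Fin (n i)) : Tensor n →ₗ[ℂ] Tensor n where
  toFun T a := if IsFar a₀ a then T a else 0
  map_add' S T := by
    funext a
    simp only [Pi.add_apply]
    split_ifs <;> simp
  map_smul' c T := by
    funext a
    simp

open Classical in
theorem farPart_apply (a₀ : (i : Fin p) → Fin (n i)) (T : Tensor n) (a : (i : Fin p) → Fin (n i)) :
    farPart a₀ T a = if IsFar a₀ a then T a else 0 :=
  rfl

/-- The index set of the coordinates of the parameters: a scalar, a tuple of matrices and a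
tensor. -/
abbrev ParamIndex (n : Fin p → ℕ) : Type :=
  Unit ⊕ (Σ i, Fin (n i) × Fin (n i)) ⊕ ((i : Fin p) → Fin (n i))

/-- The matrices of a parameter. -/
def paramMat (w : ParamIndex n → ℂ) (i : Fin p) : Matrix (Fin (n i)) (Fin (n i)) ℂ :=
  Matrix.of fun a b => w (.inr (.inl ⟨i, a, b⟩))

/-- The tensor of a parameter. -/
def paramTensor (w : ParamIndex n → ℂ) : Tensor n :=
  fun a => w (.inr (.inr a))

/-- The parameter with given components. -/
def paramMk (c : ℂ) (k : (i : Fin p) → Matrix (Fin (n i)) (Fin (n i)) ℂ) (T : Tensor n) :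
    ParamIndex n → ℂ :=
  Sum.elim (fun _ => c) (Sum.elim (fun q => k q.1 q.2.1 q.2.2) T)

theorem paramMat_mk (c : ℂ) (k : (i : Fin p) → Matrix (Fin (n i)) (Fin (n i)) ℂ) (T : Tensor n) :
    paramMat (paramMk c k T) = k :=
  rfl

theorem paramTensor_mk (c : ℂ) (k : (i : Fin p) → Matrix (Fin (n i)) (Fin (n i)) ℂ)
    (T : Tensor n) : paramTensor (paramMk c k T) = T :=
  rfl

/-- The normal vector with a given parameter. -/
noncomputable def normalParam (a₀ : (i : Fin p) → Fin (n i)) (w : ParamIndex n → ℂ) : Tensor n :=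
  act (paramMat w) (farPart a₀ (paramTensor w))

/-- The factors of the decomposable tensor with a given parameter. -/
noncomputable def pointFactor (G : (i : Fin p) → Matrix (Fin (n i)) (Fin (n i)) ℝ)
    (a₀ : (i : Fin p) → Fin (n i)) (w : ParamIndex n → ℂ) (i : Fin p) : Fin (n i) → ℂ :=
  -- The adjugate replaces the inverse to keep the parametrization polynomial; the determinants it
  -- introduces are absorbed by the scalar parameter.
  Matrix.vecMul ((paramMat w i).adjugate (a₀ i)) (gram G i)⁻¹

/-- The decomposable tensor with a given parameter. -/
noncomputable def pointParam (G : (i : Fin p) → Matrix (Fin (n i)) (Fin (n i)) ℝ)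
    (a₀ : (i : Fin p) → Fin (n i)) (w : ParamIndex n → ℂ) : Tensor n :=
  w (.inl ()) • outer (pointFactor G a₀ w)

theorem isPolyMap_normalParam (a₀ : (i : Fin p) → Fin (n i)) : IsPolyMap (normalParam a₀) := by
  classical
  refine isPolyMap_pi fun b => ?_
  simp only [normalParam, act_apply, farPart_apply, paramMat, paramTensor, Matrix.of_apply]
  refine .sum _ fun a => (IsPolyFun.prod _ fun i => isPolyFun_apply _).mul ?_
  split_ifs
  · exact isPolyFun_apply _
  · exact isPolyFun_const _

variable (G : (i : Fin p) → Matrix (Fin (n i)) (Fin (n i)) ℝ)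

theorem isPolyFun_pointFactor (a₀ : (i : Fin p) → Fin (n i)) (i : Fin p) (b : Fin (n i)) :
    IsPolyFun fun w => pointFactor G a₀ w i b := by
  classical
  simp only [pointFactor, Matrix.vecMul, dotProduct, Matrix.adjugate_apply, Matrix.det_apply']
  refine .sum _ fun c => (IsPolyFun.sum _ fun σ => (isPolyFun_const _).mul <|
    .prod _ fun j => ?_).mul (isPolyFun_const _)
  simp only [Matrix.updateRow_apply]
  split_ifs
  · exact isPolyFun_const _
  · exact isPolyFun_apply _

theorem isPolyMap_pointParam (a₀ : (i : Fin p) → Fin (n i)) : IsPolyMap (pointParam G a₀) :=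
  .smul (isPolyFun_apply _) <| isPolyMap_pi fun _ => .prod _ fun _ => isPolyFun_pointFactor G a₀ _ _

theorem pointParam_mem_rankOne (hp : 0 < p) (a₀ : (i : Fin p) → Fin (n i))
    (w : ParamIndex n → ℂ) : pointParam G a₀ w ∈ rankOne n :=
  smul_mem_rankOne hp _ ⟨_, rfl⟩

variable {G}

/-- A sum of products over far indices has derivative zero if the factors off `a₀` vanish. -/
theorem hasDerivAt_sum_prod_farPart {a₀ : (i : Fin p) → Fin (n i)}
    {f : ℂ → (i : Fin p) → Fin (n i) → ℂ} {T : ℂ → Tensor n}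
    (hf : ∀ i c, DifferentiableAt ℂ (fun ε => f ε i c) 0)
    (hT : ∀ a, DifferentiableAt ℂ (fun ε => T ε a) 0) (h0 : ∀ i c, c ≠ a₀ i → f 0 i c = 0) :
    HasDerivAt (fun ε => ∑ a, (∏ i, f ε i (a i)) * farPart a₀ (T ε) a) 0 0 := by
  classical
  have : ∀ a ∈ (Finset.univ : Finset ((i : Fin p) → Fin (n i))),
      HasDerivAt (fun ε => (∏ i, f ε i (a i)) * farPart a₀ (T ε) a) 0 0 := by
    intro a _
    simp only [farPart_apply]
    split_ifs with ha
    · obtain ⟨i, j, hij, hi, hj⟩ := ha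
      -- A far index supplies two factors vanishing at 0, so every term of the product rule
      -- vanishes.
      have hsplit : ∀ ε, (∏ l, f ε l (a l)) * T ε a = f ε i (a i) * (f ε j (a j) *
          ((∏ l ∈ (Finset.univ.erase i).erase j, f ε l (a l)) * T ε a)) := fun ε => by
        rw [← Finset.mul_prod_erase _ _ (Finset.mem_univ i),
          ← Finset.mul_prod_erase (Finset.univ.erase i) _
            (Finset.mem_erase.mpr ⟨hij.symm, Finset.mem_univ j⟩)]
        ring
      simp only [hsplit]
      have hr : DifferentiableAt ℂ
          (fun ε => (∏ l ∈ (Finset.univ.erase i).erase j, f ε l (a l)) * T ε a) 0 :=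
        (DifferentiableAt.fun_finsetProd fun l _ => hf l (a l)).mul (hT a)
      have h1 := (hf i (a i)).hasDerivAt.mul ((hf j (a j)).hasDerivAt.mul hr.hasDerivAt)
      convert! h1 using 1
      simp [h0 i _ hi, h0 j _ hj]
    · simpa using hasDerivAt_const (0 : ℂ) (0 : ℂ)
  simpa using HasDerivAt.fun_sum this

theorem vecMul_pointFactor (hG : ∀ i, (G i).PosDef) (a₀ : (i : Fin p) → Fin (n i))
    (w : ParamIndex n → ℂ) (i : Fin p) (k : Matrix (Fin (n i)) (Fin (n i)) ℂ) :
    Matrix.vecMul (pointFactor G a₀ w i) (gram G i * k) =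
      Matrix.vecMul ((paramMat w i).adjugate (a₀ i)) k := by
  rw [pointFactor, Matrix.vecMul_vecMul, ← Matrix.mul_assoc,
    Matrix.nonsing_inv_mul _ (isUnit_det_gram hG i), Matrix.one_mul]

theorem adjugate_row_vecMul {m : ℕ} (k : Matrix (Fin m) (Fin m) ℂ) (a c : Fin m) (h : c ≠ a) :
    Matrix.vecMul (k.adjugate a) k c = 0 := by
  have : (k.adjugate * k) a c = 0 := by
    rw [Matrix.adjugate_mul, Matrix.smul_apply, Matrix.one_apply_ne h.symm, smul_zero]
  exact this

/-- The Gram matrices cancel, leaving a sum over far indices. When w and w' have the same matrices,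
each factor is an entry of a row of adj(k) k and so vanishes off a₀. -/
theorem bombieriWeyl_pointParam_normalParam (hG : ∀ i, (G i).PosDef)
    (a₀ : (i : Fin p) → Fin (n i)) (w w' : ParamIndex n → ℂ) :
    bombieriWeyl G (pointParam G a₀ w) (normalParam a₀ w') =
      w (.inl ()) * ∑ a, (∏ i, Matrix.vecMul ((paramMat w i).adjugate (a₀ i)) (paramMat w' i) (a i)) *
        farPart a₀ (paramTensor w') a := by
  have h := bombieriWeyl_outer_act (G := G) (pointFactor G a₀ w) (paramMat w')
    (farPart a₀ (paramTensor w'))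
  simp only [vecMul_pointFactor hG] at h
  rw [← h, normalParam, pointParam, bombieriWeyl_eq, bombieriWeyl_eq, Finset.mul_sum]
  exact Finset.sum_congr rfl fun a _ => by rw [Pi.smul_apply, smul_eq_mul, mul_assoc]

theorem isPolyFun_adjugate_row (a₀ : (i : Fin p) → Fin (n i)) (i : Fin p) (c : Fin (n i)) :
    IsPolyFun fun w : ParamIndex n → ℂ => (paramMat w i).adjugate (a₀ i) c := by
  simp only [Matrix.adjugate_apply, Matrix.det_apply']
  refine IsPolyFun.sum _ fun σ => (isPolyFun_const _).mul <| .prod _ fun j => ?_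
  simp only [Matrix.updateRow_apply]
  split_ifs
  · exact isPolyFun_const _
  · exact isPolyFun_apply _

theorem differentiable_line (w u : ParamIndex n → ℂ) :
    Differentiable ℂ fun ε : ℂ => w + ε • u :=
  (differentiable_id.smul_const u).const_add w

/-- Moving the point to first order keeps it orthogonal to the fixed normal vector: the source of
normality to X. -/
theorem hasDerivAt_bombieriWeyl_pointParam (hG : ∀ i, (G i).PosDef)
    (a₀ : (i : Fin p) → Fin (n i)) (w u : ParamIndex n → ℂ) :
    HasDerivAt (fun ε : ℂ => bombieriWeyl G (pointParam G a₀ (w + ε • u)) (normalParam a₀ w)) 0 0 := by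
  simp only [bombieriWeyl_pointParam_normalParam hG]
  have h1 : HasDerivAt (fun ε : ℂ => ∑ a, (∏ i, Matrix.vecMul
      ((paramMat (w + ε • u) i).adjugate (a₀ i)) (paramMat w i) (a i)) *
        farPart a₀ (paramTensor w) a) 0 0 := by
    refine hasDerivAt_sum_prod_farPart (f := fun ε i => Matrix.vecMul
      ((paramMat (w + ε • u) i).adjugate (a₀ i)) (paramMat w i)) (fun i c => ?_)
      (fun a => differentiableAt_const _) fun i c hc => ?_
    · simp only [Matrix.vecMul, dotProduct]
      exact DifferentiableAt.fun_sum fun b _ => ((((isPolyFun_adjugate_row a₀ i b).differentiable).comp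
        (differentiable_line w u)) 0).mul_const _
    · simp only [zero_smul, add_zero]
      exact adjugate_row_vecMul _ _ _ hc
  have h0 : (∑ a, (∏ i, Matrix.vecMul
      ((paramMat (w + (0 : ℂ) • u) i).adjugate (a₀ i)) (paramMat w i) (a i)) *
        farPart a₀ (paramTensor w) a) = 0 := by
    refine Finset.sum_eq_zero fun a _ => ?_
    classical
    rw [farPart_apply]
    split_ifs with ha
    · obtain ⟨i, j, -, hi, -⟩ := ha
      rw [Finset.prod_eq_zero (Finset.mem_univ i), zero_mul]
      simp only [zero_smul, add_zero]
      exact adjugate_row_vecMul _ _ _ hi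
    · rw [mul_zero]
  have hc : DifferentiableAt ℂ (fun ε : ℂ => (w + ε • u) (.inl ())) 0 :=
    ((isPolyFun_apply _).differentiable.comp (differentiable_line w u)) 0
  convert! hc.hasDerivAt.mul h1 using 1
  rw [h0]
  simp

/-- The mirror statement, with the point fixed and the normal vector moving: the source of normality
to X*. -/
theorem hasDerivAt_bombieriWeyl_normalParam (hG : ∀ i, (G i).PosDef)
    (a₀ : (i : Fin p) → Fin (n i)) (w u : ParamIndex n → ℂ) :
    HasDerivAt (fun ε : ℂ => bombieriWeyl G (normalParam a₀ (w + ε • u)) (pointParam G a₀ w)) 0 0 := by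
  simp only [bombieriWeyl_comm hG (normalParam a₀ _), bombieriWeyl_pointParam_normalParam hG]
  have h1 : HasDerivAt (fun ε : ℂ => ∑ a, (∏ i, Matrix.vecMul
      ((paramMat w i).adjugate (a₀ i)) (paramMat (w + ε • u) i) (a i)) *
        farPart a₀ (paramTensor (w + ε • u)) a) 0 0 := by
    refine hasDerivAt_sum_prod_farPart (f := fun ε i => Matrix.vecMul
      ((paramMat w i).adjugate (a₀ i)) (paramMat (w + ε • u) i))
      (T := fun ε => paramTensor (w + ε • u)) (fun i c => ?_) (fun a => ?_) fun i c hc => ?_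
    · simp only [Matrix.vecMul, dotProduct]
      exact DifferentiableAt.fun_sum fun b _ => ((((isPolyFun_apply
        (.inr (.inl ⟨i, b, c⟩))).differentiable).comp (differentiable_line w u)) 0).const_mul _
    · exact ((isPolyFun_apply (.inr (.inr a))).differentiable.comp (differentiable_line w u)) 0
    · simp only [zero_smul, add_zero]
      exact adjugate_row_vecMul _ _ _ hc
  simpa using h1.const_mul (w (.inl ()))

end

end TensorData

/-! ### The conormal varieties of X and X* -/

namespace TensorData

section

variable {p : ℕ} {n : Fin p → ℕ} {G : (i : Fin p) → Matrix (Fin (n i)) (Fin (n i)) ℝ}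

theorem exists_isUnit_row_eq {m : ℕ} (x : Fin m → ℂ) (hx : x ≠ 0) (a : Fin m) :
    ∃ g : Matrix (Fin m) (Fin m) ℂ, IsUnit g.det ∧ g a = x := by
  classical
  have hs : (Pi.single a 1 : Fin m → ℂ) ≠ 0 := by simp
  obtain ⟨e, he⟩ := SeparatingDual.exists_continuousLinearEquiv_apply_eq (R := ℂ) hs hx
  refine ⟨(LinearMap.toMatrix' (e.toLinearEquiv : (Fin m → ℂ) →ₗ[ℂ] (Fin m → ℂ))).transpose,
    ?_, ?_⟩
  · rw [Matrix.det_transpose, LinearMap.det_toMatrix']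
    exact LinearEquiv.isUnit_det' e.toLinearEquiv
  · funext b
    rw [Matrix.transpose_apply, LinearMap.toMatrix'_apply]
    exact congrFun he b

/-- A decomposable tensor with nonzero factors together with a tensor orthogonal to the tangent
directions has a parameter. -/
theorem exists_param_of_orthogonal (hp : 0 < p) (hG : ∀ i, (G i).PosDef)
    (a₀ : (i : Fin p) → Fin (n i)) {x : (i : Fin p) → Fin (n i) → ℂ} (hx : ∀ i, x i ≠ 0)
    {y : Tensor n} (hy : ∀ i v, bombieriWeyl G (outer (Function.update x i v)) y = 0) :
    ∃ w, pointParam G a₀ w = outer x ∧ normalParam a₀ w = y := by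
  classical
  have hx' : ∀ i, Matrix.vecMul (x i) (gram G i) ≠ 0 := fun i h => by
    refine hx i (Matrix.eq_zero_of_vecMul_eq_zero (isUnit_det_gram hG i).ne_zero h)
  -- Row a₀ i of g i is the functional ⟨x i, ·⟩. With k the inverse of g, the a₀-row of adj(k i) is
  -- det(k i) times this functional, and the scalar d⁻¹ removes the determinants.
  choose g hg hgx using fun i => exists_isUnit_row_eq _ (hx' i) (a₀ i)
  let k := fun i => (g i)⁻¹
  let d := ∏ i, (k i).det
  have hkd : ∀ i, (k i).det ≠ 0 := fun i =>
    (Matrix.isUnit_nonsing_inv_det _ (hg i)).ne_zero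
  have hadj : ∀ i, (k i).adjugate (a₀ i) = (k i).det • Matrix.vecMul (x i) (gram G i) := fun i => by
    have h1 : (k i).adjugate = (k i).det • g i := by
      have h2 := Matrix.adjugate_mul (k i)
      have h3 : k i * g i = 1 := Matrix.nonsing_inv_mul _ (hg i)
      calc (k i).adjugate = (k i).adjugate * (k i * g i) := by rw [h3, Matrix.mul_one]
        _ = _ := by rw [← Matrix.mul_assoc, h2, Matrix.smul_mul, Matrix.one_mul]
    rw [h1, ← hgx i]
    rfl
  refine ⟨paramMk d⁻¹ k (act g y), ?_, ?_⟩
  · have h1 : pointFactor G a₀ (paramMk d⁻¹ k (act g y)) = fun i => (k i).det • x i := by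
      funext i
      rw [pointFactor, paramMat_mk, hadj, Matrix.smul_vecMul, Matrix.vecMul_vecMul,
        Matrix.mul_nonsing_inv _ (isUnit_det_gram hG i), Matrix.vecMul_one]
    rw [pointParam, h1, outer_smul, smul_smul]
    change (d⁻¹ * d) • outer x = outer x
    rw [inv_mul_cancel₀ (Finset.prod_ne_zero_iff.mpr fun i _ => hkd i), one_smul]
  -- An entry of g·y at a non-far index is the pairing of y with x changed in at most one position,
  -- which is zero by `hy`.
  · have h1 : farPart a₀ (act g y) = act g y := by
      funext a
      rw [farPart_apply]
      split_ifs with ha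
      · rfl
      · obtain ⟨i, hi⟩ : ∃ i, ∀ l, l ≠ i → a l = a₀ l := by
          by_cases h : ∃ i, a i ≠ a₀ i
          · obtain ⟨i, hi⟩ := h
            refine ⟨i, fun l hl => ?_⟩
            by_contra h2
            exact ha ⟨i, l, hl.symm, hi, h2⟩
          · push Not at h
            exact ⟨⟨0, hp⟩, fun l _ => h l⟩
        have h2 := hy i (Matrix.vecMul (g i (a i)) (gram G i)⁻¹)
        have h3 := bombieriWeyl_outer_act (G := G)
          (Function.update x i (Matrix.vecMul (g i (a i)) (gram G i)⁻¹)) (fun _ => 1) y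
        rw [act_one, h2] at h3
        rw [act_apply]
        rw [h3]
        refine Finset.sum_congr rfl fun b _ => ?_
        congr 1
        refine Finset.prod_congr rfl fun l _ => ?_
        rw [Matrix.mul_one]
        by_cases hl : l = i
        · subst hl
          rw [Function.update_self, Matrix.vecMul_vecMul,
            Matrix.nonsing_inv_mul _ (isUnit_det_gram hG l), Matrix.vecMul_one]
        · rw [Function.update_of_ne hl, ← hgx l, hi l hl]
    rw [normalParam, paramMat_mk, paramTensor_mk, h1, act_act]
    conv_rhs => rw [← act_one y]
    congr 2
    funext i
    exact Matrix.nonsing_inv_mul _ (hg i)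

theorem outer_update_mem_tangentSpace (x : (i : Fin p) → Fin (n i) → ℂ) (i : Fin p)
    (v : Fin (n i) → ℂ) :
    outer (Function.update x i v) ∈ tangentSpace (rankOne n) (outer x) := by
  have h : HasDerivAt (fun ε : ℂ => outer x + ε • outer (Function.update x i v))
      (outer (Function.update x i v)) 0 := by
    simpa using ((hasDerivAt_id (0 : ℂ)).smul_const (outer (Function.update x i v))).const_add
      (outer x)
  have := mem_tangentSpace_of_hasDerivAt (Z := rankOne n) h fun ε => by
    refine ⟨Function.update x i (x i + ε • v), ?_⟩
    rw [outer_update_add, outer_update_smul, Function.update_eq_self]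
  simpa using this

/-- X is a cone containing every basis vector, so the lines through the origin in X span the whole
space. The only normal vector at 0 is therefore 0. -/
theorem tangentSpace_rankOne_zero (hp : 0 < p) : tangentSpace (rankOne n) 0 = ⊤ := by
  classical
  rw [eq_top_iff]
  intro v _
  rw [pi_eq_sum_univ' v]
  refine Submodule.sum_mem _ fun a _ => Submodule.smul_mem _ _ ?_
  have h : HasDerivAt (fun ε : ℂ => ε • (Pi.single a 1 : Tensor n)) (Pi.single a 1) 0 := by
    simpa using (hasDerivAt_id (0 : ℂ)).smul_const (Pi.single a 1 : Tensor n)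
  have := mem_tangentSpace_of_hasDerivAt (Z := rankOne n) h fun ε => by
    rw [single_eq_outer]
    exact smul_mem_rankOne hp _ ⟨_, rfl⟩
  simpa using this

theorem param_zero (a₀ : (i : Fin p) → Fin (n i)) :
    pointParam G a₀ 0 = 0 ∧ normalParam a₀ (0 : ParamIndex n → ℂ) = 0 := by
  constructor
  · simp [pointParam]
  · have : paramTensor (0 : ParamIndex n → ℂ) = 0 := rfl
    rw [normalParam, this, map_zero, map_zero]

theorem zariskiClosure_range_pointParam (hp : 0 < p) (hG : ∀ i, (G i).PosDef)
    (a₀ : (i : Fin p) → Fin (n i)) :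
    zariskiClosure (Set.range (pointParam G a₀)) = rankOne n := by
  apply Set.Subset.antisymm
  · refine (zariskiClosure_mono ?_).trans (zariskiClosure_rankOne_subset hp)
    rintro _ ⟨w, rfl⟩
    exact pointParam_mem_rankOne G hp a₀ w
  · refine Set.Subset.trans ?_ (subset_zariskiClosure _)
    rintro _ ⟨x, rfl⟩
    by_cases hx : ∀ i, x i ≠ 0
    · obtain ⟨w, hw, -⟩ := exists_param_of_orthogonal hp hG a₀ hx (y := 0) fun i v => by
        simp [bombieriWeyl]
      exact ⟨w, hw⟩
    · push Not at hx
      obtain ⟨i, hi⟩ := hx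
      rw [outer_eq_zero hi]
      exact ⟨0, (param_zero a₀).1⟩

/-- At a general parameter the point is regular and every tangent vector is a derivative of the
parametrization, hence orthogonal to the normal vector. Density extends membership in the closed
conormal variety to all parameters. -/
theorem param_mem_conormal (hp : 0 < p) (hG : ∀ i, (G i).PosDef) (a₀ : (i : Fin p) → Fin (n i))
    (w : ParamIndex n → ℂ) : (pointParam G a₀ w, normalParam a₀ w) ∈ conormal G (rankOne n) := by
  obtain ⟨g, hg, h⟩ := generic_smoothness (isPolyMap_pointParam G a₀)
  rw [zariskiClosure_range_pointParam hp hG] at h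
  refine mem_zariskiClosure_of_maps (φ := fun w => (pointParam G a₀ w, normalParam a₀ w))
    ((isPolyMap_pointParam G a₀).prodMk (isPolyMap_normalParam a₀)) (fun w hw => ?_)
    (mem_zariskiClosure_of_isOpen (isOpen_eval_ne_zero g) ?_ w)
  · refine subset_zariskiClosure _ ⟨(h w hw).1, fun v hv => ?_⟩
    obtain ⟨u, hu⟩ := (h w hw).2 v hv
    exact (hasDerivAt_bombieriWeyl_left hu _).unique (hasDerivAt_bombieriWeyl_pointParam hG a₀ w u)
  · obtain ⟨w, -, hw⟩ := exists_eval_ne_zero_of_isOpen isOpen_univ Set.univ_nonempty hg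
    exact ⟨w, hw⟩

theorem conormal_subset (hp : 0 < p) (hG : ∀ i, (G i).PosDef) (a₀ : (i : Fin p) → Fin (n i)) :
    conormal G (rankOne n) ⊆
      zariskiClosure (Set.range fun w => (pointParam G a₀ w, normalParam a₀ w)) := by
  refine zariskiClosure_mono ?_
  rintro ⟨x, y⟩ ⟨hx, hy⟩
  dsimp only at hx hy
  obtain ⟨⟨x, rfl⟩, -⟩ := id hx
  by_cases hx0 : ∀ i, x i ≠ 0
  · obtain ⟨w, hw1, hw2⟩ := exists_param_of_orthogonal hp hG a₀ hx0 (y := y) fun i v =>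
      hy _ (outer_update_mem_tangentSpace x i v)
    exact ⟨w, Prod.ext hw1 hw2⟩
  · push Not at hx0
    obtain ⟨i, hi⟩ := hx0
    rw [outer_eq_zero hi] at hx hy ⊢
    have hy0 : y = 0 := eq_zero_of_bombieriWeyl hG fun S =>
      hy S (by rw [tangentSpace_rankOne_zero hp]; trivial)
    rw [hy0]
    exact ⟨0, Prod.ext (param_zero a₀).1 (param_zero (G := G) a₀).2⟩

theorem dualVariety_eq (hp : 0 < p) (hG : ∀ i, (G i).PosDef) (a₀ : (i : Fin p) → Fin (n i)) :
    dualVariety G (rankOne n) = zariskiClosure (Set.range (normalParam a₀)) := by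
  apply Set.Subset.antisymm
  · refine zariskiClosure_minimal ?_
    rintro _ ⟨q, hq, rfl⟩
    have h : ∀ s ∈ Set.range fun w => (pointParam G a₀ w, normalParam a₀ w),
        s.2 ∈ zariskiClosure (Set.range (normalParam a₀)) := by
      rintro _ ⟨w, rfl⟩
      exact subset_zariskiClosure _ ⟨w, rfl⟩
    exact mem_zariskiClosure_of_maps isPolyMap_snd h (conormal_subset hp hG a₀ hq)
  · refine zariskiClosure_mono ?_
    rintro _ ⟨w, rfl⟩
    exact ⟨_, param_mem_conormal hp hG a₀ w, rfl⟩

/-- One inclusion of biduality: the same parameters, swapped, with generic smoothness now applied to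
the parametrization of X*. -/
theorem param_mem_conormal_dualVariety (hp : 0 < p) (hG : ∀ i, (G i).PosDef)
    (a₀ : (i : Fin p) → Fin (n i)) (w : ParamIndex n → ℂ) :
    (normalParam a₀ w, pointParam G a₀ w) ∈ conormal G (dualVariety G (rankOne n)) := by
  obtain ⟨g, hg, h⟩ := generic_smoothness (isPolyMap_normalParam a₀)
  rw [← dualVariety_eq hp hG] at h
  refine mem_zariskiClosure_of_maps (φ := fun w => (normalParam a₀ w, pointParam G a₀ w))
    ((isPolyMap_normalParam a₀).prodMk (isPolyMap_pointParam G a₀)) (fun w hw => ?_)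
    (mem_zariskiClosure_of_isOpen (isOpen_eval_ne_zero g) ?_ w)
  · refine subset_zariskiClosure _ ⟨(h w hw).1, fun v hv => ?_⟩
    obtain ⟨u, hu⟩ := (h w hw).2 v hv
    exact (hasDerivAt_bombieriWeyl_left hu _).unique (hasDerivAt_bombieriWeyl_normalParam hG a₀ w u)
  · obtain ⟨w, -, hw⟩ := exists_eval_ne_zero_of_isOpen isOpen_univ Set.univ_nonempty hg
    exact ⟨w, hw⟩

end

end TensorData

/-! ### Symmetric matrices of maximal rank and the Hessian at a basis tensor -/

namespace TensorData

section

/-- At a point of maximal rank of a linear family of symmetric matrices, the quadratic forms of the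
family vanish on the kernel. -/
theorem quadratic_eq_zero_of_max_rank {κ V : Type*} [Fintype κ] [DecidableEq κ] [AddCommGroup V]
    [Module ℂ V] (H : V →ₗ[ℂ] Matrix κ κ ℂ) (hsymm : ∀ Y, (H Y).transpose = H Y) {N : ℕ}
    (hN : ∀ Y, (H Y).rank ≤ N) {Y₀ : V} {e : Fin N → κ → ℂ}
    (he : LinearIndependent ℂ fun i => (H Y₀).mulVec (e i)) {τ : κ → ℂ}
    (hτ : (H Y₀).mulVec τ = 0) (Y : V) : τ ⬝ᵥ (H Y).mulVec τ = 0 := by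
  by_contra hne
  -- For ε ≠ 0 these N + 1 vectors lie in the range of H(Y₀ + εY), because H(Y₀) τ = 0. Independence
  -- at ε = 0 is an open condition, so it would contradict the maximality of N.
  let f : ℂ → Option (Fin N) → κ → ℂ := fun ε o =>
    o.elim ((H Y).mulVec τ) fun i => (H Y₀).mulVec (e i) + ε • (H Y).mulVec (e i)
  have hcont : Continuous f := by
    refine continuous_pi fun o => ?_
    cases o with
    | none => exact continuous_const
    | some i => exact continuous_const.add (continuous_id.smul continuous_const)
  have h0 : LinearIndependent ℂ (f 0) := by
    rw [linearIndependent_option]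
    refine ⟨by simpa [f, Function.comp_def] using he, fun hmem => hne ?_⟩
    -- By symmetry the range of H(Y₀) is orthogonal to its kernel vector τ, whereas H(Y) τ pairs
    -- with τ to a nonzero number.
    have hle : Submodule.span ℂ (Set.range (f 0 ∘ some)) ≤
        LinearMap.ker (dotProductBilin ℂ ℂ τ) := by
      rw [Submodule.span_le]
      rintro _ ⟨i, rfl⟩
      change τ ⬝ᵥ ((H Y₀).mulVec (e i) + (0 : ℂ) • (H Y).mulVec (e i)) = 0
      rw [zero_smul, add_zero, Matrix.dotProduct_mulVec, ← hsymm Y₀, Matrix.vecMul_transpose, hτ,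
        zero_dotProduct]
    exact hle hmem
  have hev : ∀ᶠ ε in nhds (0 : ℂ), LinearIndependent ℂ (f ε) :=
    hcont.continuousAt.eventually (isOpen_setOfPred_linearIndependent.mem_nhds h0)
  obtain ⟨ε, hε, hε0⟩ := ((hev.filter_mono nhdsWithin_le_nhds).and
    (self_mem_nhdsWithin : ∀ᶠ ε in nhdsWithin (0 : ℂ) {0}ᶜ, ε ∈ ({0}ᶜ : Set ℂ))).exists
  have hε0 : ε ≠ 0 := hε0
  have hadd : ∀ v, (H (Y₀ + ε • Y)).mulVec v = (H Y₀).mulVec v + ε • (H Y).mulVec v := fun v => by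
    rw [map_add, map_smul, Matrix.add_mulVec, Matrix.smul_mulVec]
  have hrange : ∀ o, f ε o ∈ LinearMap.range (H (Y₀ + ε • Y)).mulVecLin := by
    intro o
    cases o with
    | none =>
      refine ⟨ε⁻¹ • τ, ?_⟩
      rw [Matrix.mulVecLin_apply, Matrix.mulVec_smul, hadd, hτ, zero_add, smul_smul,
        inv_mul_cancel₀ hε0, one_smul]
      rfl
    | some i => exact ⟨e i, by rw [Matrix.mulVecLin_apply, hadd]; rfl⟩
  have h1 : LinearIndependent ℂ fun o =>
      (⟨f ε o, hrange o⟩ : LinearMap.range (H (Y₀ + ε • Y)).mulVecLin) :=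
    LinearIndependent.of_comp (Submodule.subtype _) hε
  have h2 := h1.fintype_card_le_finrank
  have h3 := hN (Y₀ + ε • Y)
  rw [Fintype.card_option, Fintype.card_fin] at h2
  rw [Matrix.rank] at h3
  omega

theorem exists_max_rank {κ V : Type*} [Fintype κ] [DecidableEq κ] [AddCommGroup V]
    [Module ℂ V] (H : V →ₗ[ℂ] Matrix κ κ ℂ) : ∃ (N : ℕ) (Y₀ : V) (e : Fin N → κ → ℂ),
    (∀ Y, (H Y).rank ≤ N) ∧ LinearIndependent ℂ fun i => (H Y₀).mulVec (e i) := by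
  have hb : BddAbove (Set.range fun Y => (H Y).rank) :=
    ⟨Fintype.card κ, by rintro _ ⟨Y, rfl⟩; exact Matrix.rank_le_card_width _⟩
  obtain ⟨Y₀, hY₀⟩ := Nat.sSup_mem (Set.range_nonempty _) hb
  have hmax : ∀ Y, (H Y).rank ≤ (H Y₀).rank := fun Y => by
    have := le_csSup hb ⟨Y, rfl⟩
    exact this.trans hY₀.ge
  let b := Module.finBasis ℂ (LinearMap.range (H Y₀).mulVecLin)
  choose e he using fun i => (b i).2
  refine ⟨_, Y₀, e, hmax, ?_⟩
  have : (fun i => (H Y₀).mulVec (e i)) =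
      fun i => (LinearMap.range (H Y₀).mulVecLin).subtype (b i) := funext he
  rw [this]
  exact b.linearIndependent.map' _ (Submodule.ker_subtype _)

variable {p : ℕ} {n : Fin p → ℕ}

/-- The Hessian at `outer e_{a₀}` of the form defined by a tensor. -/
noncomputable def hessian (a₀ : (i : Fin p) → Fin (n i)) :
    Tensor n →ₗ[ℂ] Matrix (Σ i, Fin (n i)) (Σ i, Fin (n i)) ℂ where
  toFun Y := Matrix.of fun s t => if s.1 = t.1 then 0 else
    farPart a₀ Y (Function.update (Function.update a₀ t.1 t.2) s.1 s.2)
  map_add' Y Z := by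
    ext s t
    simp only [map_add, Matrix.of_apply, Matrix.add_apply, Pi.add_apply]
    split_ifs <;> simp
  map_smul' c Y := by
    ext s t
    simp

theorem hessian_apply (a₀ : (i : Fin p) → Fin (n i)) (Y : Tensor n) (s t : Σ i, Fin (n i)) :
    hessian a₀ Y s t = if s.1 = t.1 then 0 else
      farPart a₀ Y (Function.update (Function.update a₀ t.1 t.2) s.1 s.2) :=
  rfl

theorem hessian_transpose (a₀ : (i : Fin p) → Fin (n i)) (Y : Tensor n) :
    (hessian a₀ Y).transpose = hessian a₀ Y := by
  ext s t
  simp only [Matrix.transpose_apply, hessian_apply]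
  by_cases h : s.1 = t.1
  · rw [if_pos h, if_pos h.symm]
  · rw [if_neg h, if_neg (Ne.symm h), Function.update_comm h]

/-- The values of a tensor at the indices that differ from `a₀` in exactly one position. -/
noncomputable def nearPart (a₀ : (i : Fin p) → Fin (n i)) (t : Tensor n) (s : Σ i, Fin (n i)) : ℂ :=
  if s.2 = a₀ s.1 then 0 else t (Function.update a₀ s.1 s.2)

theorem farPart_update (a₀ : (i : Fin p) → Fin (n i)) (Y : Tensor n) (i : Fin p) (γ : Fin (n i)) :
    farPart a₀ Y (Function.update a₀ i γ) = 0 := by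
  classical
  rw [farPart_apply, if_neg]
  rintro ⟨j, l, hjl, hj, hl⟩
  have h1 : j = i := by
    by_contra h
    exact hj (Function.update_of_ne h _ _)
  have h2 : l = i := by
    by_contra h
    exact hl (Function.update_of_ne h _ _)
  exact hjl (h1.trans h2.symm)

theorem exists_eq_update_of_not_isFar {a₀ a : (i : Fin p) → Fin (n i)} (h : ¬ IsFar a₀ a)
    {i : Fin p} (hi : a i ≠ a₀ i) : a = Function.update a₀ i (a i) := by
  funext l
  by_cases hl : l = i
  · subst hl; simp
  · rw [Function.update_of_ne hl]
    by_contra h2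
    exact h ⟨i, l, Ne.symm hl, hi, h2⟩

/-- Interprets an entry of the product as the pairing of t with the infinitesimal action, in
position i, of an elementary matrix on the far part of Y. Such directions are tangent to X*. -/
theorem hessian_mulVec_nearPart (a₀ : (i : Fin p) → Fin (n i)) (Y t : Tensor n)
    (ht : ∀ a, IsFar a₀ a → t a = 0) (i : Fin p) (γ : Fin (n i)) :
    (hessian a₀ Y).mulVec (nearPart a₀ t) ⟨i, γ⟩ =
      ∑ a, t a * (if a i = a₀ i then farPart a₀ Y (Function.update a i γ) else 0) := by
  classical
  simp only [Matrix.mulVec, dotProduct]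
  refine Finset.sum_bij_ne_zero (fun s _ _ => Function.update a₀ s.1 s.2) (fun _ _ _ => Finset.mem_univ _)
    ?_ ?_ ?_
  · rintro ⟨l, c⟩ - h1 ⟨l', c'⟩ - h2 heq
    have hc : c ≠ a₀ l := fun h => h1 (by simp [nearPart, h])
    have hc' : c' ≠ a₀ l' := fun h => h2 (by simp [nearPart, h])
    dsimp only at heq
    have hl : l = l' := by
      by_contra h
      have := congrFun heq l
      rw [Function.update_self, Function.update_of_ne h] at this
      exact hc this
    subst hl
    have := congrFun heq l
    rw [Function.update_self, Function.update_self] at this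
    rw [this]
  · intro a _ ha
    have hta : t a ≠ 0 := left_ne_zero_of_mul ha
    have hai : a i = a₀ i := by
      by_contra h
      exact ha (by rw [if_neg h, mul_zero])
    have hnf : ¬ IsFar a₀ a := fun h => hta (ht a h)
    by_cases h : ∃ l, a l ≠ a₀ l
    · obtain ⟨l, hl⟩ := h
      have hal := exists_eq_update_of_not_isFar hnf hl
      refine ⟨⟨l, a l⟩, Finset.mem_univ _, ?_, hal.symm⟩
      have hil : i ≠ l := by
        rintro rfl
        exact hl hai
      rw [hessian_apply, if_neg hil, nearPart, if_neg hl]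
      dsimp only
      rw [← hal]
      rw [if_pos hai] at ha
      rwa [mul_comm]
    · push Not at h
      rw [funext h, if_pos rfl, farPart_update, mul_zero] at ha
      exact absurd rfl ha
  · rintro ⟨l, c⟩ - h
    have hc : c ≠ a₀ l := fun hc => h (by simp [nearPart, hc])
    have hil : i ≠ l := fun hil => h (by rw [hessian_apply, if_pos hil, zero_mul])
    rw [hessian_apply, if_neg hil, nearPart, if_neg hc, if_pos (Function.update_of_ne hil _ _),
      mul_comm]

/-- Testing the quadratic forms on the single basis tensor at a₀ modified in positions i and l
isolates twice the required product. -/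
theorem mul_nearPart_eq_zero (a₀ : (i : Fin p) → Fin (n i)) (t : Tensor n)
    (h : ∀ Y, nearPart a₀ t ⬝ᵥ (hessian a₀ Y).mulVec (nearPart a₀ t) = 0) {i l : Fin p}
    (hil : i ≠ l) (γ : Fin (n i)) (c : Fin (n l)) :
    nearPart a₀ t ⟨i, γ⟩ * nearPart a₀ t ⟨l, c⟩ = 0 := by
  classical
  by_cases hγ : γ = a₀ i
  · simp [nearPart, hγ]
  by_cases hc : c = a₀ l
  · simp [nearPart, hc]
  set τ := nearPart a₀ t with hτ
  have hτ0 : ∀ s : Σ i, Fin (n i), s.2 = a₀ s.1 → τ s = 0 := fun s hs => by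
    rw [hτ, nearPart, if_pos hs]
  let a := Function.update (Function.update a₀ l c) i γ
  have hai : a i = γ := Function.update_self _ _ _
  have hal : a l = c := by
    simp only [a]
    rw [Function.update_of_ne hil.symm, Function.update_self]
  have hao : ∀ j, j ≠ i → j ≠ l → a j = a₀ j := fun j hi hl => by
    simp only [a]
    rw [Function.update_of_ne hi, Function.update_of_ne hl]
  have hfar : IsFar a₀ a := ⟨i, l, hil, by rwa [hai], by rwa [hal]⟩
  have hH : ∀ s t : Σ i, Fin (n i), τ s * (hessian a₀ (Pi.single a 1) s t * τ t) =
      if (s = ⟨i, γ⟩ ∧ t = ⟨l, c⟩) ∨ (s = ⟨l, c⟩ ∧ t = ⟨i, γ⟩) then τ s * τ t else 0 := by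
    rintro ⟨j, b⟩ ⟨m, d⟩
    by_cases hb : b = a₀ j
    · rw [hτ0 ⟨j, b⟩ hb]; simp
    by_cases hd : d = a₀ m
    · rw [hτ0 ⟨m, d⟩ hd]; simp
    rw [hessian_apply]
    dsimp only
    by_cases hjm : j = m
    · subst hjm
      rw [if_pos rfl, if_neg]
      · simp
      · rintro (⟨h1, h2⟩ | ⟨h1, h2⟩)
        · exact hil ((congrArg Sigma.fst h1).symm.trans (congrArg Sigma.fst h2))
        · exact hil ((congrArg Sigma.fst h2).symm.trans (congrArg Sigma.fst h1))
    rw [if_neg hjm]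
    have hsup : ∀ a', farPart a₀ (Pi.single a 1 : Tensor n) a' = if a' = a then 1 else 0 := by
      intro a'
      rw [farPart_apply, Pi.single_apply]
      split_ifs with h1 h2 h2 <;> first | rfl | skip
      rw [h2] at h1
      exact absurd hfar h1
    rw [hsup]
    have hiff : Function.update (Function.update a₀ m d) j b = a ↔
        ((⟨j, b⟩ : Σ i, Fin (n i)) = ⟨i, γ⟩ ∧ (⟨m, d⟩ : Σ i, Fin (n i)) = ⟨l, c⟩) ∨
        ((⟨j, b⟩ : Σ i, Fin (n i)) = ⟨l, c⟩ ∧ (⟨m, d⟩ : Σ i, Fin (n i)) = ⟨i, γ⟩) := by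
      constructor
      · intro heq
        have hj : a j = b := by rw [← heq, Function.update_self]
        have hm : a m = d := by
          rw [← heq, Function.update_of_ne (Ne.symm hjm), Function.update_self]
        have hj' : j = i ∨ j = l := by
          by_contra! h'
          exact hb (hj ▸ hao j h'.1 h'.2)
        have hm' : m = i ∨ m = l := by
          by_contra! h'
          exact hd (hm ▸ hao m h'.1 h'.2)
        rcases hj' with rfl | rfl <;> rcases hm' with rfl | rfl
        · exact absurd rfl hjm
        · left; rw [← hj, ← hm, hai, hal]; exact ⟨rfl, rfl⟩
        · right; rw [← hj, ← hm, hai, hal]; exact ⟨rfl, rfl⟩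
        · exact absurd rfl hjm
      · rintro (⟨h1, h2⟩ | ⟨h1, h2⟩)
        · cases h1; cases h2; rfl
        · cases h1; cases h2; exact Function.update_comm hil _ _ _
    simp only [hiff]
    split_ifs <;> simp
  have h1 := h (Pi.single a 1)
  simp only [Matrix.mulVec, dotProduct, Finset.mul_sum, hH] at h1
  have hne : (⟨i, γ⟩ : Σ i, Fin (n i)) ≠ ⟨l, c⟩ := fun h' => hil (congrArg Sigma.fst h')
  rw [← Finset.sum_product'] at h1
  rw [← Finset.sum_filter] at h1
  have hfilter : (Finset.univ ×ˢ Finset.univ : Finset ((Σ i, Fin (n i)) × (Σ i, Fin (n i)))).filter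
      (fun q => (q.1 = ⟨i, γ⟩ ∧ q.2 = ⟨l, c⟩) ∨ (q.1 = ⟨l, c⟩ ∧ q.2 = ⟨i, γ⟩)) =
      {(⟨i, γ⟩, ⟨l, c⟩), (⟨l, c⟩, ⟨i, γ⟩)} := by
    ext ⟨s, t⟩
    simp [Prod.ext_iff]
  rw [hfilter, Finset.sum_pair (by simp [Prod.ext_iff, hne])] at h1
  dsimp only at h1
  rw [mul_comm (τ ⟨l, c⟩), ← two_mul] at h1
  exact (mul_eq_zero.mp h1).resolve_left two_ne_zero

/-- A tensor supported near `a₀` whose blocks have at most one nonzero member is decomposable. -/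
theorem mem_rankOne_of_nearPart (hp : 0 < p) (a₀ : (i : Fin p) → Fin (n i)) (t : Tensor n)
    (ht : ∀ a, IsFar a₀ a → t a = 0)
    (h : ∀ {i l : Fin p}, i ≠ l → ∀ γ c, nearPart a₀ t ⟨i, γ⟩ * nearPart a₀ t ⟨l, c⟩ = 0) :
    t ∈ rankOne n := by
  classical
  obtain ⟨l, hl⟩ : ∃ l, ∀ i, i ≠ l → ∀ γ, nearPart a₀ t ⟨i, γ⟩ = 0 := by
    by_cases h0 : ∃ l c, nearPart a₀ t ⟨l, c⟩ ≠ 0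
    · obtain ⟨l, c, hc⟩ := h0
      exact ⟨l, fun i hi γ => (mul_eq_zero.mp (h hi γ c)).resolve_right hc⟩
    · push Not at h0
      exact ⟨⟨0, hp⟩, fun i _ γ => h0 i γ⟩
  refine ⟨Function.update (fun i => Pi.single (a₀ i) 1) l fun c => t (Function.update a₀ l c), ?_⟩
  funext a
  rw [outer, ← Finset.mul_prod_erase _ _ (Finset.mem_univ l), Function.update_self]
  by_cases ha : ∃ i, i ≠ l ∧ a i ≠ a₀ i
  · obtain ⟨i, hi, hai⟩ := ha
    have hta : t a = 0 := by
      by_cases hf : IsFar a₀ a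
      · exact ht a hf
      · have h1 := hl i hi (a i)
        rw [nearPart, if_neg hai] at h1
        rwa [exists_eq_update_of_not_isFar hf hai]
    rw [hta, Finset.prod_eq_zero (Finset.mem_erase.mpr ⟨hi, Finset.mem_univ i⟩), mul_zero]
    rw [Function.update_of_ne hi, Pi.single_eq_of_ne hai]
  · push Not at ha
    have : Function.update a₀ l (a l) = a := by
      funext i
      by_cases hi : i = l
      · subst hi; simp
      · rw [Function.update_of_ne hi, ha i hi]
    rw [this, Finset.prod_eq_one, mul_one]
    intro i hi
    rw [Function.update_of_ne (Finset.ne_of_mem_erase hi), ha i (Finset.ne_of_mem_erase hi),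
      Pi.single_eq_same]

end

end TensorData

/-! ### Gradients of the equations of X* -/

namespace TensorData

section

variable {p : ℕ} {n : Fin p → ℕ} {G : (i : Fin p) → Matrix (Fin (n i)) (Fin (n i)) ℝ}

/-- The gradient of a polynomial. -/
noncomputable def gradient (f : MvPolynomial ((i : Fin p) → Fin (n i)) ℂ) (y : Tensor n) :
    Tensor n :=
  fun b => MvPolynomial.eval y (MvPolynomial.pderiv b f)

theorem isPolyMap_gradient (f : MvPolynomial ((i : Fin p) → Fin (n i)) ℂ) :
    IsPolyMap (gradient f) :=
  isPolyMap_pi fun _ => isPolyFun_eval _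

theorem sum_gradient_eq_zero {Z : Set (Tensor n)} {f : MvPolynomial ((i : Fin p) → Fin (n i)) ℂ}
    (hf : ∀ z ∈ Z, MvPolynomial.eval z f = 0) {y v : Tensor n}
    (h : ∀ ε : ℂ, y + ε • v ∈ Z) : ∑ b, gradient f y b * v b = 0 := by
  have h1 : HasDerivAt (fun ε : ℂ => y + ε • v) v 0 := by
    simpa using ((hasDerivAt_id (0 : ℂ)).smul_const v).const_add y
  have h2 := mem_tangentSpace.mp (mem_tangentSpace_of_hasDerivAt h1 h) f hf
  rw [differentialAt_apply] at h2
  simpa [gradient] using h2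

/-- At a general point of the dual variety, every equation has a decomposable gradient. -/
theorem gradient_mem_rankOne (hp : 0 < p) {a₀ : (i : Fin p) → Fin (n i)}
    {f : MvPolynomial ((i : Fin p) → Fin (n i)) ℂ}
    (hf : ∀ z ∈ Set.range (normalParam a₀), MvPolynomial.eval z f = 0)
    {N : ℕ} (hN : ∀ Y, (hessian a₀ Y).rank ≤ N) {e : Fin N → (Σ i, Fin (n i)) → ℂ}
    {w : ParamIndex n → ℂ} (hdet : ∀ i, (paramMat w i).det ≠ 0)
    (he : LinearIndependent ℂ fun i => (hessian a₀ (paramTensor w)).mulVec (e i)) :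
    gradient f (normalParam a₀ w) ∈ rankOne n := by
  classical
  set k := paramMat w with hk
  set Y := paramTensor w with hY
  set t := act (fun i => (k i).transpose) (gradient f (normalParam a₀ w)) with ht
  -- A line through the point that stays in X* gives a tangent vector, and t is the gradient pulled
  -- back by the matrices k.
  have hpair : ∀ v, (∀ ε : ℂ, farPart a₀ Y + ε • v ∈
      {T | act k T ∈ Set.range (normalParam a₀)}) → ∑ a, t a * v a = 0 := by
    intro v hv
    rw [ht, ← sum_mul_act]
    refine sum_gradient_eq_zero hf fun ε => ?_
    have := hv ε
    rw [Set.mem_ofPred_eq, map_add, map_smul] at this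
    exact this
  have hfar : ∀ a, IsFar a₀ a → t a = 0 := by
    intro a ha
    have h1 := hpair (Pi.single a 1) fun ε => ⟨paramMk 0 k (Y + ε • Pi.single a 1), by
      rw [normalParam, paramMat_mk, paramTensor_mk, map_add, map_smul]
      congr 3
      funext b
      rw [farPart_apply, Pi.single_apply]
      split_ifs with h1 h2 h2
      · rfl
      · rfl
      · rw [h2] at h1; exact absurd ha h1
      · rfl⟩
    simpa [Pi.single_apply] using h1
  have hker : (hessian a₀ Y).mulVec (nearPart a₀ t) = 0 := by
    funext ⟨i, γ⟩
    rw [hessian_mulVec_nearPart a₀ Y t hfar, Pi.zero_apply]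
    have hv : ∀ a, (if a i = a₀ i then farPart a₀ Y (Function.update a i γ) else 0) =
        act (Function.update (fun _ => 1) i (Matrix.single (a₀ i) γ 1)) (farPart a₀ Y) a := by
      intro a
      rw [act_update_one, Finset.sum_eq_single γ]
      · by_cases h : a i = a₀ i
        · rw [if_pos h, h, Matrix.single_apply_same, one_mul]
        · rw [if_neg h, Matrix.single_apply_of_row_ne (Ne.symm h), zero_mul]
      · intro c _ hc
        rw [Matrix.single_apply_of_col_ne _ _ (Ne.symm hc), zero_mul]
      · simp
    simp only [hv]
    refine hpair _ fun ε => ?_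
    -- Only one matrix of the tuple is perturbed, so the resulting path in the image of
    -- `normalParam` is affine in ε.
    let E : (l : Fin p) → Matrix (Fin (n l)) (Fin (n l)) ℂ :=
      Function.update (fun _ => 1) i (1 + ε • Matrix.single (a₀ i) γ 1)
    refine ⟨paramMk 0 (fun l => k l * E l) Y, ?_⟩
    rw [normalParam, paramMat_mk, paramTensor_mk, ← act_act]
    congr 1
    funext a
    rw [Pi.add_apply, Pi.smul_apply, act_update_one, act_update_one]
    simp only [Matrix.add_apply, Matrix.smul_apply, smul_eq_mul, add_mul, Finset.sum_add_distrib,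
      Finset.mul_sum, mul_assoc]
    congr 1
    rw [Finset.sum_eq_single (a i)]
    · simp
    · intro c _ hc
      rw [Matrix.one_apply_ne hc.symm, zero_mul]
    · simp
  have ht1 : t ∈ rankOne n := mem_rankOne_of_nearPart hp a₀ t hfar fun hil γ c =>
    mul_nearPart_eq_zero a₀ t (quadratic_eq_zero_of_max_rank (hessian a₀) (hessian_transpose a₀)
      hN he hker) hil γ c
  have h2 := act_mem_rankOne (fun i => ((k i).transpose)⁻¹) ht1
  rw [ht, act_act] at h2
  have h3 : (fun i => ((k i).transpose)⁻¹ * (k i).transpose) = fun _ => 1 := funext fun i =>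
    Matrix.nonsing_inv_mul _ (by rw [Matrix.det_transpose]; exact isUnit_iff_ne_zero.mpr (hdet i))
  rwa [h3, act_one] at h2

theorem continuous_paramMat_det (i : Fin p) :
    Continuous fun w : ParamIndex n → ℂ => (paramMat w i).det := by
  refine Continuous.matrix_det ?_
  exact continuous_matrix fun a b => continuous_apply _

theorem continuous_hessian_mulVec (a₀ : (i : Fin p) → Fin (n i)) (e : (Σ i, Fin (n i)) → ℂ) :
    Continuous fun w : ParamIndex n → ℂ => (hessian a₀ (paramTensor w)).mulVec e := by
  classical
  refine continuous_pi fun s => ?_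
  simp only [Matrix.mulVec, dotProduct, hessian_apply, farPart_apply, paramTensor]
  refine continuous_finsetSum _ fun t _ => Continuous.mul ?_ continuous_const
  split_ifs
  · exact continuous_const
  · exact continuous_apply _
  · exact continuous_const

/-- Invertible matrices together with a Hessian of maximal rank form a nonempty open set of
parameters. Decomposability of the gradient holds there and passes to all of X*, singular points
included, because X is closed. -/
theorem act_inv_gradient_mem_rankOne (hp : 0 < p) (a₀ : (i : Fin p) → Fin (n i))
    (g : (i : Fin p) → Matrix (Fin (n i)) (Fin (n i)) ℂ)
    {f : MvPolynomial ((i : Fin p) → Fin (n i)) ℂ}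
    (hf : ∀ z ∈ zariskiClosure (Set.range (normalParam a₀)), MvPolynomial.eval z f = 0)
    {y : Tensor n} (hy : y ∈ zariskiClosure (Set.range (normalParam a₀))) :
    act g (gradient f y) ∈ rankOne n := by
  classical
  have hφ : IsPolyMap fun y => act g (gradient f y) :=
    (isPolyMap_linear (act g)).comp (isPolyMap_gradient f)
  refine zariskiClosure_rankOne_subset hp (mem_zariskiClosure_of_maps hφ ?_ hy)
  rintro _ ⟨w, rfl⟩
  obtain ⟨N, Y₀, e, hN, he⟩ := exists_max_rank (hessian a₀)
  let U : Set (ParamIndex n → ℂ) := (⋂ i, {w | (paramMat w i).det ≠ 0}) ∩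
    {w | LinearIndependent ℂ fun i => (hessian a₀ (paramTensor w)).mulVec (e i)}
  have hU : IsOpen U := by
    refine IsOpen.inter (isOpen_iInter_of_finite fun i => ?_) ?_
    · exact isOpen_ne_fun (continuous_paramMat_det i) continuous_const
    · exact isOpen_setOfPred_linearIndependent.preimage
        (continuous_pi fun i => continuous_hessian_mulVec a₀ (e i))
  have hUne : U.Nonempty := by
    refine ⟨paramMk 0 (fun _ => 1) Y₀, Set.mem_iInter.mpr fun i => ?_, he⟩
    rw [Set.mem_ofPred_eq, paramMat_mk, Matrix.det_one]
    exact one_ne_zero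
  refine mem_zariskiClosure_of_maps (hφ.comp (isPolyMap_normalParam a₀)) (fun w hw => ?_)
    (mem_zariskiClosure_of_isOpen hU hUne w)
  exact subset_zariskiClosure _ (act_mem_rankOne g (gradient_mem_rankOne hp
    (fun z hz => hf z (subset_zariskiClosure _ hz)) hN (Set.mem_iInter.mp hw.1) hw.2))

/-- The second component of the conormal variety of `X*` lies in `X`. -/
theorem snd_mem_rankOne_of_mem_conormal (hp : 0 < p) (hG : ∀ i, (G i).PosDef)
    (a₀ : (i : Fin p) → Fin (n i)) {q : Tensor n × Tensor n}
    (hq : q ∈ conormal G (dualVariety G (rankOne n))) : q.2 ∈ rankOne n := by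
  classical
  have h : ∀ s ∈ {q : Tensor n × Tensor n | q.1 ∈ regularLocus (dualVariety G (rankOne n)) ∧
      q.2 ∈ normalSpace G (dualVariety G (rankOne n)) q.1}, s.2 ∈ zariskiClosure (rankOne n) := by
    rintro ⟨y, z⟩ ⟨hy, hz⟩
    dsimp only at hy hz ⊢
    -- Pairing with z kills the tangent space, so it is the differential of an equation of X*: z is
    -- a gradient transported by the inverse Gram matrices.
    obtain ⟨f, hf, hfd⟩ := exists_differentialAt_eq (Z := dualVariety G (rankOne n)) (z := y)
      (∑ b, act (gram G) z b • LinearMap.proj b) fun v hv => by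
        have := hz v hv
        rw [bombieriWeyl_eq] at this
        simpa [LinearMap.sum_apply, mul_comm] using this
    have hgr : act (gram G) z = gradient f y := by
      funext b
      have := LinearMap.congr_fun hfd (Pi.single b 1)
      rw [differentialAt_apply] at this
      simpa [LinearMap.sum_apply, Pi.single_apply, gradient, eq_comm] using this
    rw [dualVariety_eq hp hG a₀] at hf
    have hy1 := hy.1
    rw [dualVariety_eq hp hG a₀] at hy1
    rw [← act_inv_act_gram hG z, hgr]
    exact subset_zariskiClosure _ (act_inv_gradient_mem_rankOne hp a₀ _ hf hy1)
  exact zariskiClosure_rankOne_subset hp (mem_zariskiClosure_of_maps isPolyMap_snd h hq)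

end

end TensorData

/-! ### The theorem's parts (a) and (b), and the substitution method -/

namespace TensorData

section

variable {p : ℕ} {n : Fin p → ℕ} {G : (i : Fin p) → Matrix (Fin (n i)) (Fin (n i)) ℝ}

/-! ### Data loci -/

theorem conormal_zero_mem_of_subsingleton [Subsingleton (Tensor n)] {Z : Set (Tensor n)}
    (hZ : Z.Nonempty) (q : Tensor n × Tensor n) : q ∈ conormal G Z := by
  obtain ⟨z, hz⟩ := hZ
  refine zariskiClosure_nonempty_of_subsingleton (S := {q : Tensor n × Tensor n |
    q.1 ∈ regularLocus Z ∧ q.2 ∈ normalSpace G Z q.1}) ⟨(z, 0), ⟨hz, fun w _ => ?_⟩, fun v _ => ?_⟩ q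
  · rw [Subsingleton.elim z w]
  · simp [bombieriWeyl]

theorem dualVariety_nonempty_of_subsingleton [Subsingleton (Tensor n)] {Z : Set (Tensor n)}
    (hZ : Z.Nonempty) (y : Tensor n) : y ∈ dualVariety G Z :=
  subset_zariskiClosure _ ⟨(y, y), conormal_zero_mem_of_subsingleton hZ _, rfl⟩

theorem subsingleton_or_exists_index (n : Fin p → ℕ) :
    Subsingleton (Tensor n) ∨ Nonempty ((i : Fin p) → Fin (n i)) := by
  cases isEmpty_or_nonempty ((i : Fin p) → Fin (n i)) with
  | inl h => exact .inl inferInstance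
  | inr h => exact .inr h

theorem normalParam_mem_dualVariety (hp : 0 < p) (hG : ∀ i, (G i).PosDef)
    (a₀ : (i : Fin p) → Fin (n i)) (w : ParamIndex n → ℂ) :
    normalParam a₀ w ∈ dualVariety G (rankOne n) := by
  rw [dualVariety_eq hp hG a₀]
  exact subset_zariskiClosure _ ⟨w, rfl⟩

/-- The form in which the parametrization is used for data loci. If some n i = 0 there is no base
index a₀, but then the tensor space is zero. -/
theorem mem_conormal_dualVariety_of_orthogonal (hp : 0 < p) (hG : ∀ i, (G i).PosDef)
    {x : (i : Fin p) → Fin (n i) → ℂ} (hx : ∀ i, x i ≠ 0) {y : Tensor n}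
    (hy : ∀ i v, bombieriWeyl G (outer (Function.update x i v)) y = 0) :
    y ∈ dualVariety G (rankOne n) ∧ (y, outer x) ∈ conormal G (dualVariety G (rankOne n)) := by
  rcases subsingleton_or_exists_index n with h | ⟨⟨a₀⟩⟩
  · have h1 := dualVariety_nonempty_of_subsingleton (G := G) ⟨0, zero_mem_rankOne (n := n) hp⟩ y
    exact ⟨h1, conormal_zero_mem_of_subsingleton ⟨y, h1⟩ _⟩
  · obtain ⟨w, hw1, hw2⟩ := exists_param_of_orthogonal hp hG a₀ hx hy
    rw [← hw1, ← hw2]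
    exact ⟨normalParam_mem_dualVariety hp hG a₀ w, param_mem_conormal_dualVariety hp hG a₀ w⟩

theorem zero_mem_conormal_dualVariety (hp : 0 < p) (hG : ∀ i, (G i).PosDef)
    {x : Tensor n} (hx : x ∈ rankOne n) :
    0 ∈ dualVariety G (rankOne n) ∧ (0, x) ∈ conormal G (dualVariety G (rankOne n)) := by
  obtain ⟨x, rfl⟩ := hx
  by_cases h : ∀ i, x i ≠ 0
  · exact mem_conormal_dualVariety_of_orthogonal hp hG h fun i v => by simp [bombieriWeyl]
  push Not at h
  obtain ⟨i, hi⟩ := h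
  rw [outer_eq_zero hi]
  rcases subsingleton_or_exists_index n with h | ⟨⟨a₀⟩⟩
  · have h1 := dualVariety_nonempty_of_subsingleton (G := G) ⟨0, zero_mem_rankOne (n := n) hp⟩ 0
    exact ⟨h1, conormal_zero_mem_of_subsingleton ⟨0, h1⟩ _⟩
  · have h1 := normalParam_mem_dualVariety hp hG a₀ 0
    have h2 := param_mem_conormal_dualVariety hp hG a₀ 0
    rw [(param_zero (G := G) a₀).2] at h1 h2
    rw [(param_zero (G := G) a₀).1] at h2
    exact ⟨h1, h2⟩

theorem add_mem_dataLocus {A : Set (Tensor n)} {y z : Tensor n} (hy : y ∈ A)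
    (h : (y, z) ∈ conormal G (dualVariety G (rankOne n))) : y + z ∈ dataLocus G A :=
  subset_zariskiClosure _ ⟨(y, z, y + z), ⟨subset_zariskiClosure _ ⟨h, rfl⟩, hy⟩, rfl⟩

theorem mem_jointED {Z : Set (Tensor n)} {q : Tensor n × Tensor n × Tensor n}
    (hq : q ∈ jointED G Z) : (q.1, q.2.1) ∈ conormal G Z ∧ q.2.2 = q.1 + q.2.1 := by
  constructor
  · exact mem_zariskiClosure_of_maps (φ := fun q : Tensor n × Tensor n × Tensor n => (q.1, q.2.1))
      (isPolyMap_fst.prodMk (isPolyMap_fst.comp isPolyMap_snd)) (fun s hs => hs.1) hq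
  · funext a
    have h : IsPolyFun fun q : Tensor n × Tensor n × Tensor n => q.2.2 a - (q.1 a + q.2.1 a) :=
      ((isPolyMap_snd.comp isPolyMap_snd).apply a).sub
        ((isPolyMap_fst.apply a).add ((isPolyMap_fst.comp isPolyMap_snd).apply a))
    refine sub_eq_zero.mp (mem_zariskiClosure.mp hq _ h fun s hs => ?_)
    rw [hs.2, Pi.add_apply, sub_self]

/-- With `DL_succ`, this propagates the inclusion of DL_1 in DL_2 to all later steps. -/
theorem dataLocus_mono {A B : Set (Tensor n)} (h : A ⊆ B) : dataLocus G A ⊆ dataLocus G B :=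
  zariskiClosure_mono (Set.image_mono (Set.inter_subset_inter_right _ fun _ hq => h hq))

theorem dataLocus_subset {A C : Set (Tensor n)}
    (h : ∀ y ∈ A, ∀ z, (y, z) ∈ conormal G (dualVariety G (rankOne n)) → y + z ∈ zariskiClosure C) :
    dataLocus G A ⊆ zariskiClosure C := by
  refine zariskiClosure_minimal ?_
  rintro _ ⟨q, ⟨hq, hqA⟩, rfl⟩
  obtain ⟨h1, h2⟩ := mem_jointED hq
  dsimp only
  rw [h2]
  exact h _ hqA _ h1

theorem DL_succ {r : ℕ} (hr : 1 ≤ r) :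
    DL G (r + 1) = dataLocus G (dualVariety G (rankOne n) ∩ DL G r) := by
  obtain ⟨r, rfl⟩ := Nat.exists_eq_add_of_le' hr
  rfl

theorem DL_subset_succ (hp : 0 < p) (hG : ∀ i, (G i).PosDef) {r : ℕ} (hr : 1 ≤ r) :
    DL G r ⊆ DL (n := n) G (r + 1) := by
  induction r, hr using Nat.le_induction with
  | base =>
    intro x hx
    have hx : x ∈ rankOne n := hx
    obtain ⟨h1, h2⟩ := zero_mem_conormal_dualVariety hp hG hx
    rw [DL_succ le_rfl, ← zero_add x]
    exact add_mem_dataLocus ⟨h1, zero_mem_rankOne hp⟩ h2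
  | succ r hr ih =>
    rw [DL_succ hr, DL_succ (hr.trans (Nat.le_succ r))]
    exact dataLocus_mono (Set.inter_subset_inter_right _ ih)

theorem DL_mono (hp : 0 < p) (hG : ∀ i, (G i).PosDef) {r s : ℕ} (hr : 1 ≤ r) (hrs : r ≤ s) :
    DL G r ⊆ DL (n := n) G s := by
  induction s, hrs using Nat.le_induction with
  | base => exact Set.Subset.rfl
  | succ s hs ih => exact ih.trans (DL_subset_succ hp hG (hr.trans hs))

/-! ### Rank and border rank -/

theorem exists_sum_outer (hp : 0 < p) (T : Tensor n) :
    ∃ (k : ℕ) (x : Fin k → (i : Fin p) → Fin (n i) → ℂ), T = ∑ j, outer (x j) := by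
  classical
  let e := Fintype.equivFin ((i : Fin p) → Fin (n i))
  choose x hx using fun a => smul_mem_rankOne hp (T a) ⟨_, (single_eq_outer a).symm⟩
  refine ⟨_, fun j => x (e.symm j), ?_⟩
  rw [Equiv.sum_comp e.symm fun a => outer (x a)]
  simp only [hx]
  exact pi_eq_sum_univ' T

theorem tensorRank_le_iff (hp : 0 < p) {T : Tensor n} {k : ℕ} :
    tensorRank T ≤ k ↔ ∃ x : Fin k → (i : Fin p) → Fin (n i) → ℂ, T = ∑ j, outer (x j) := by
  refine ⟨fun h => ?_, fun h => Nat.sInf_le h⟩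
  -- Every tensor has some decomposition, so the infimum is attained and is not the default value 0
  -- of an empty set.
  obtain ⟨x, hx⟩ : ∃ x : Fin (tensorRank T) → (i : Fin p) → Fin (n i) → ℂ, T = ∑ j, outer (x j) :=
    Nat.sInf_mem (exists_sum_outer hp T)
  obtain ⟨d, rfl⟩ := Nat.exists_eq_add_of_le h
  refine ⟨Fin.append x fun _ => 0, hx.trans ?_⟩
  rw [Fin.sum_univ_add]
  simp only [Fin.append_left, Fin.append_right, outer_eq_zero (i := (⟨0, hp⟩ : Fin p))
    (x := (0 : (i : Fin p) → Fin (n i) → ℂ)) rfl, Finset.sum_const_zero, add_zero]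

theorem tensorRank_outer_le (x : (i : Fin p) → Fin (n i) → ℂ) : tensorRank (outer x) ≤ 1 :=
  Nat.sInf_le ⟨fun _ => x, by simp⟩

theorem tensorRank_add_le (hp : 0 < p) (S T : Tensor n) :
    tensorRank (S + T) ≤ tensorRank S + tensorRank T := by
  obtain ⟨x, hx⟩ := (tensorRank_le_iff hp).mp (le_refl (tensorRank S))
  obtain ⟨y, hy⟩ := (tensorRank_le_iff hp).mp (le_refl (tensorRank T))
  refine (tensorRank_le_iff hp).mpr ⟨Fin.append x y, ?_⟩
  rw [Fin.sum_univ_add]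
  simp only [Fin.append_left, Fin.append_right]
  rw [← hx, ← hy]

theorem tensorRank_act_le (hp : 0 < p) (g : (i : Fin p) → Matrix (Fin (n i)) (Fin (n i)) ℂ)
    (T : Tensor n) : tensorRank (act g T) ≤ tensorRank T := by
  obtain ⟨x, hx⟩ := (tensorRank_le_iff hp).mp (le_refl (tensorRank T))
  refine (tensorRank_le_iff hp).mpr ⟨fun j i => (g i).mulVec (x j i), ?_⟩
  conv_lhs => rw [hx]
  rw [map_sum]
  simp only [act_outer]

/-- Each step adds a z in X to a tensor of the previous locus, and translation by z is a polynomial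
map, so it respects closures. -/
theorem DL_subset_zariskiClosure (hp : 0 < p) (hG : ∀ i, (G i).PosDef) {r : ℕ} (hr : 1 ≤ r) :
    DL G r ⊆ zariskiClosure {S : Tensor n | tensorRank S ≤ r} := by
  induction r, hr using Nat.le_induction with
  | base =>
    rintro _ ⟨x, rfl⟩
    exact subset_zariskiClosure _ (tensorRank_outer_le x)
  | succ r hr ih =>
    rw [DL_succ hr]
    refine dataLocus_subset fun y hy z hz => ?_
    have hz1 : z ∈ rankOne n := by
      rcases subsingleton_or_exists_index n with h | ⟨⟨a₀⟩⟩
      · rw [Subsingleton.elim z 0]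
        exact zero_mem_rankOne hp
      · exact snd_mem_rankOne_of_mem_conormal hp hG a₀ hz
    refine mem_zariskiClosure_of_maps (φ := fun y => y + z) (isPolyMap_id.add (isPolyMap_const z))
      (fun s hs => subset_zariskiClosure _ ?_) (ih hy.2)
    obtain ⟨x, rfl⟩ := hz1
    exact (tensorRank_add_le hp _ _).trans (add_le_add hs (tensorRank_outer_le x))

/-! ### Sums of orthogonal decomposable tensors -/

/-- Two tuples of vectors are orthogonal in at least two positions. -/
def TwoOrthogonal (G : (i : Fin p) → Matrix (Fin (n i)) (Fin (n i)) ℝ)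
    (x y : (i : Fin p) → Fin (n i) → ℂ) : Prop :=
  ∃ i j, i ≠ j ∧ complexForm (G i) (x i) (y i) = 0 ∧ complexForm (G j) (x j) (y j) = 0

theorem TwoOrthogonal.bombieriWeyl_update {x y : (i : Fin p) → Fin (n i) → ℂ}
    (h : TwoOrthogonal G x y) (i : Fin p) (v : Fin (n i) → ℂ) :
    bombieriWeyl G (outer (Function.update x i v)) (outer y) = 0 := by
  obtain ⟨j, l, hjl, hj, hl⟩ := h
  rw [bombieriWeyl_outer]
  by_cases h : j = i
  · refine Finset.prod_eq_zero (Finset.mem_univ l) ?_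
    rw [Function.update_of_ne (fun h' => hjl (h.trans h'.symm)), hl]
  · refine Finset.prod_eq_zero (Finset.mem_univ j) ?_
    rw [Function.update_of_ne h, hj]

theorem bombieriWeyl_sum_right {κ : Type*} (s : Finset κ) (S : Tensor n) (T : κ → Tensor n) :
    bombieriWeyl G S (∑ k ∈ s, T k) = ∑ k ∈ s, bombieriWeyl G S (T k) := by
  simp only [bombieriWeyl_eq, map_sum, Finset.sum_apply, Finset.mul_sum]
  exact Finset.sum_comm

theorem outer_add_mem_DL (hp : 0 < p) (hG : ∀ i, (G i).PosDef) {r : ℕ} (hr : 1 ≤ r)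
    {y : Tensor n} (hy : y ∈ DL G r) {x : (i : Fin p) → Fin (n i) → ℂ}
    (h : ∀ i v, bombieriWeyl G (outer (Function.update x i v)) y = 0) :
    y + outer x ∈ DL G (r + 1) := by
  by_cases hx : ∀ i, x i ≠ 0
  · obtain ⟨h1, h2⟩ := mem_conormal_dualVariety_of_orthogonal hp hG hx h
    rw [DL_succ hr]
    exact add_mem_dataLocus ⟨h1, hy⟩ h2
  · push Not at hx
    obtain ⟨i, hi⟩ := hx
    rw [outer_eq_zero hi, add_zero]
    exact DL_subset_succ hp hG hr hy

/-- Orthogonality in two positions survives a change of one factor, so each new summand is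
normal-compatible with the sum of the previous ones and costs one step. -/
theorem sum_outer_mem_DL (hp : 0 < p) (hG : ∀ i, (G i).PosDef) {m r : ℕ} (hr : 1 ≤ r)
    (hmr : m ≤ r) (x : Fin m → (i : Fin p) → Fin (n i) → ℂ)
    (hx : ∀ k l, k ≠ l → TwoOrthogonal G (x k) (x l)) : ∑ k, outer (x k) ∈ DL G r := by
  -- The loci start at index 1, so the empty sum must be placed in DL_1.
  refine DL_mono hp hG (r := max m 1) (le_max_right _ _) (max_le hmr hr) ?_
  clear hmr hr
  induction m with
  | zero =>
    rw [Finset.univ_eq_empty, Finset.sum_empty]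
    exact zero_mem_rankOne hp
  | succ m ih =>
    rw [Fin.sum_univ_castSucc]
    rcases Nat.eq_zero_or_pos m with rfl | hm
    · rw [Finset.univ_eq_empty, Finset.sum_empty]
      exact ⟨_, (zero_add _).symm⟩
    · have h1 := ih (fun k => x k.castSucc) fun k l hkl =>
        hx _ _ fun h => hkl (Fin.castSucc_injective m h)
      rw [max_eq_left hm] at h1
      rw [max_eq_left (Nat.succ_le_succ (Nat.zero_le m))]
      refine outer_add_mem_DL hp hG hm h1 fun i v => ?_
      rw [bombieriWeyl_sum_right]
      exact Finset.sum_eq_zero fun k _ =>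
        (hx _ _ (Fin.castSucc_lt_last k).ne').bombieriWeyl_update i v

end

section

variable {p : ℕ} {n : Fin p → ℕ}

/-! ### The substitution method -/

/-- The product of the factors of a decomposable tensor other than the one in position `i`. -/
noncomputable def cofactor (x : (i : Fin p) → Fin (n i) → ℂ) (i : Fin p) : Tensor n :=
  fun a => ∏ l ∈ Finset.univ.erase i, x l (a l)

theorem outer_apply_eq (x : (i : Fin p) → Fin (n i) → ℂ) (i : Fin p)
    (a : (i : Fin p) → Fin (n i)) : outer x a = x i (a i) * cofactor x i a :=
  (Finset.mul_prod_erase _ _ (Finset.mem_univ i)).symm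

theorem cofactor_update (x : (i : Fin p) → Fin (n i) → ℂ) (i : Fin p) (u : Fin (n i) → ℂ) :
    cofactor (Function.update x i u) i = cofactor x i := by
  funext a
  exact Finset.prod_congr rfl fun l hl => by rw [Function.update_of_ne (Finset.ne_of_mem_erase hl)]

theorem outer_update_apply (x : (i : Fin p) → Fin (n i) → ℂ) (i : Fin p) (u : Fin (n i) → ℂ)
    (a : (i : Fin p) → Fin (n i)) :
    outer (Function.update x i u) a = u (a i) * cofactor x i a := by
  rw [outer_apply_eq _ i, cofactor_update, Function.update_self]

theorem cofactor_apply_update (x : (i : Fin p) → Fin (n i) → ℂ) (i : Fin p)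
    (a : (i : Fin p) → Fin (n i)) (c : Fin (n i)) :
    cofactor x i (Function.update a i c) = cofactor x i a :=
  Finset.prod_congr rfl fun l hl => by rw [Function.update_of_ne (Finset.ne_of_mem_erase hl)]

/-- The contraction of a tensor in position `i`. -/
noncomputable def contract (i : Fin p) (β : Fin (n i) → ℂ) : Tensor n →ₗ[ℂ] Tensor n where
  -- The result stays in the same tensor space and does not depend on the index in position i;
  -- `cofactor` follows the same convention.
  toFun T a := ∑ c, β c * T (Function.update a i c)
  map_add' S T := by
    funext a
    simp [mul_add, Finset.sum_add_distrib]
  map_smul' r T := by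
    funext a
    simp [Finset.mul_sum, mul_left_comm]

theorem contract_outer (i : Fin p) (β : Fin (n i) → ℂ) (x : (i : Fin p) → Fin (n i) → ℂ) :
    contract i β (outer x) = (β ⬝ᵥ x i) • cofactor x i := by
  funext a
  change ∑ c, β c * outer x (Function.update a i c) = _
  simp only [outer_apply_eq x i, cofactor_apply_update, Function.update_self, ← mul_assoc]
  rw [← Finset.sum_mul]
  rfl

/-- The action of a matrix in position `i`. -/
noncomputable def actAt (i : Fin p) (E : Matrix (Fin (n i)) (Fin (n i)) ℂ) :
    Tensor n →ₗ[ℂ] Tensor n :=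
  act (Function.update (fun _ => 1) i E)

theorem actAt_outer (i : Fin p) (E : Matrix (Fin (n i)) (Fin (n i)) ℂ)
    (x : (i : Fin p) → Fin (n i) → ℂ) :
    actAt i E (outer x) = outer (Function.update x i (E.mulVec (x i))) := by
  rw [actAt, act_outer]
  congr 1
  funext l
  by_cases hl : l = i
  · subst hl; simp
  · rw [Function.update_of_ne hl, Function.update_of_ne hl, Matrix.one_mulVec]

theorem tensorRank_sum_le (hp : 0 < p) {κ : Type*} (s : Finset κ)
    (x : κ → (i : Fin p) → Fin (n i) → ℂ) : tensorRank (∑ k ∈ s, outer (x k)) ≤ s.card := by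
  classical
  induction s using Finset.induction_on with
  | empty => exact (tensorRank_le_iff hp).mpr ⟨Fin.elim0, by
      rw [Finset.sum_empty]
      exact (Finset.sum_eq_zero fun k _ => Fin.elim0 k).symm⟩
  | insert k s hk ih =>
    rw [Finset.sum_insert hk, Finset.card_insert_of_notMem hk, add_comm s.card]
    exact (tensorRank_add_le hp _ _).trans (add_le_add (tensorRank_outer_le _) ih)

/-- The substitution method: if the contractions of `T` by `d` functionals are linearly
independent, then subtracting suitable multiples of them lowers the rank by `d`. -/
theorem exists_substitution (hp : 0 < p) (i : Fin p) {T : Tensor n} {R : ℕ}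
    (hT : tensorRank T ≤ R) {P : Matrix (Fin (n i)) (Fin (n i)) ℂ} (hP : actAt i P T = T)
    {κ : Type} [Fintype κ] [DecidableEq κ] (β : κ → Fin (n i) → ℂ)
    (hli : LinearIndependent ℂ fun k => contract i (β k) T) :
    ∃ σ : κ → Fin (n i) → ℂ, (∀ k l, β k ⬝ᵥ P.mulVec (σ l) = if k = l then 1 else 0) ∧
      tensorRank (T - ∑ k, fun a => P.mulVec (σ k) (a i) * contract i (β k) T a) +
        Fintype.card κ ≤ R := by
  classical
  obtain ⟨x, hx⟩ := (tensorRank_le_iff hp).mp hT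
  let u : Fin R → Fin (n i) → ℂ := fun s => P.mulVec (x s i)
  have hTu : T = ∑ s, outer (Function.update (x s) i (u s)) := by
    conv_lhs => rw [← hP, hx, map_sum]
    simp only [actAt_outer, u]
  let v : Fin R → κ → ℂ := fun s k => β k ⬝ᵥ u s
  have hB : ∀ k, contract i (β k) T = ∑ s, v s k • cofactor (x s) i := fun k => by
    conv_lhs => rw [hTu, map_sum]
    refine Finset.sum_congr rfl fun s _ => ?_
    rw [contract_outer, cofactor_update, Function.update_self]
  -- A functional vanishing on all v s would be a linear relation among the contractions of T.
  have hspan : Submodule.span ℂ (Set.range v) = ⊤ := by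
    rw [← Subspace.dualAnnihilator_inj, Submodule.dualAnnihilator_top, eq_bot_iff]
    intro φ hφ
    rw [Submodule.mem_dualAnnihilator] at hφ
    have h1 : ∑ k, φ (Pi.single k 1) • contract i (β k) T = 0 := by
      simp only [hB, Finset.smul_sum, smul_smul]
      rw [Finset.sum_comm]
      refine Finset.sum_eq_zero fun s _ => ?_
      rw [← Finset.sum_smul]
      have h2 := hφ (v s) (Submodule.subset_span ⟨s, rfl⟩)
      rw [pi_eq_sum_univ' (v s), map_sum] at h2
      simp only [map_smul, smul_eq_mul] at h2
      rw [Finset.sum_congr rfl fun k _ => mul_comm _ _, h2, zero_smul]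
    have h3 := Fintype.linearIndependent_iff.mp hli _ h1
    refine LinearMap.pi_ext' fun k => LinearMap.ext_ring ?_
    exact h3 k
  obtain ⟨ι, a, ha, hsp, hind⟩ := exists_linearIndependent' ℂ v
  have : Finite ι := Finite.of_injective a ha
  have : Fintype ι := Fintype.ofFinite ι
  let b : Module.Basis ι ℂ (κ → ℂ) := Module.Basis.mk hind (by rw [hsp, hspan])
  have hb : ∀ j, b j = v (a j) := fun j => by simp [b]
  -- Chosen so that the linear map c ↦ ∑ c k • P σ k sends each basis vector v (a j) to u (a j).
  -- Subtracting then annihilates one summand for each basis vector, `Fintype.card κ` in all.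
  let σ : κ → Fin (n i) → ℂ := fun k => ∑ j, b.repr (Pi.single k 1) j • x (a j) i
  have hσ : ∀ k, P.mulVec (σ k) = ∑ j, b.repr (Pi.single k 1) j • u (a j) := fun k => by
    simp only [σ, u, Matrix.mulVec_sum, Matrix.mulVec_smul]
  have hσu : ∀ j, ∑ k, v (a j) k • P.mulVec (σ k) = u (a j) := fun j => by
    simp only [hσ, Finset.smul_sum, smul_smul]
    rw [Finset.sum_comm]
    have h1 : ∀ j', ∑ k, v (a j) k * b.repr (Pi.single k 1) j' = b.repr (v (a j)) j' := fun j' => by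
      conv_rhs => rw [pi_eq_sum_univ' (v (a j))]
      simp
    simp only [← Finset.sum_smul, h1]
    rw [← hb, b.repr_self, Finset.sum_eq_single j]
    · simp
    · intro j' _ hj'
      simp [hj'.symm]
    · simp
  refine ⟨σ, fun k l => ?_, ?_⟩
  · have h1 := congrFun (b.sum_repr (Pi.single l 1)) k
    rw [hσ, dotProduct_sum]
    simp only [dotProduct_smul]
    simp only [hb, Finset.sum_apply, Pi.smul_apply] at h1
    refine Eq.trans h1 ?_
    rw [Pi.single_apply]
  · have hdiff : T - ∑ k, (fun a => P.mulVec (σ k) (a i) * contract i (β k) T a) =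
        ∑ s ∈ Finset.univ \ Finset.univ.image a,
          outer (Function.update (x s) i (u s - ∑ k, v s k • P.mulVec (σ k))) := by
      have h1 : T - ∑ k, (fun a => P.mulVec (σ k) (a i) * contract i (β k) T a) =
          ∑ s, outer (Function.update (x s) i (u s - ∑ k, v s k • P.mulVec (σ k))) := by
        funext c
        have h2 : ∀ k, contract i (β k) T c = ∑ s, v s k * cofactor (x s) i c := fun k => by
          rw [hB, Finset.sum_apply]; rfl
        have h3 := (congrFun hTu c).trans (Finset.sum_apply _ _ _)
        rw [Pi.sub_apply, Finset.sum_apply, Finset.sum_apply, h3]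
        simp only [h2, outer_update_apply, Pi.sub_apply, Finset.sum_apply, Pi.smul_apply,
          smul_eq_mul, sub_mul, Finset.sum_sub_distrib, Finset.mul_sum, Finset.sum_mul]
        congr 1
        rw [Finset.sum_comm]
        exact Finset.sum_congr rfl fun s _ => Finset.sum_congr rfl fun k _ => by ring
      rw [h1]
      refine (Finset.sum_subset (Finset.subset_univ _) fun s _ hs => ?_).symm
      simp only [Finset.mem_sdiff, Finset.mem_univ, true_and, not_not, Finset.mem_image] at hs
      obtain ⟨j, rfl⟩ := hs
      rw [hσu, sub_self]
      exact outer_eq_zero (i := i) (by simp)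
    have hcard : Fintype.card ι = Fintype.card κ := by
      rw [← Module.finrank_eq_card_basis b, Module.finrank_fintype_fun_eq_card]
    rw [hdiff]
    have h1 := tensorRank_sum_le hp (Finset.univ \ Finset.univ.image a) fun s =>
      Function.update (x s) i (u s - ∑ k, v s k • P.mulVec (σ k))
    have h2 : (Finset.univ \ Finset.univ.image a).card + Fintype.card ι = R := by
      rw [Finset.card_sdiff_of_subset (Finset.subset_univ _), Finset.card_image_of_injective _ ha,
        Finset.card_univ, Finset.card_univ, Fintype.card_fin]
      have := Fintype.card_le_of_injective a ha
      rw [Fintype.card_fin] at this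
      omega
    omega

/-! ### Orthogonal decompositions -/

variable {G : (i : Fin p) → Matrix (Fin (n i)) (Fin (n i)) ℝ}

theorem complexForm_eq_dotProduct (i : Fin p) (x y : Fin (n i) → ℂ) :
    complexForm (G i) x y = Matrix.vecMul x (gram G i) ⬝ᵥ y := by
  simp only [complexForm, Matrix.vecMul, dotProduct, gram, Matrix.map_apply, Finset.sum_mul]
  rw [Finset.sum_comm]
  exact Finset.sum_congr rfl fun a _ => Finset.sum_congr rfl fun b _ => by ring

/-- The functional dual to a nonisotropic vector. -/
noncomputable def dualVector (G : (i : Fin p) → Matrix (Fin (n i)) (Fin (n i)) ℝ) (i : Fin p)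
    (x : Fin (n i) → ℂ) : Fin (n i) → ℂ :=
  (complexForm (G i) x x)⁻¹ • Matrix.vecMul x (gram G i)

theorem dualVector_dotProduct (i : Fin p) (x y : Fin (n i) → ℂ) :
    dualVector G i x ⬝ᵥ y = (complexForm (G i) x x)⁻¹ * complexForm (G i) x y := by
  rw [dualVector, smul_dotProduct, ← complexForm_eq_dotProduct, smul_eq_mul]

theorem cofactor_ne_zero {x : (i : Fin p) → Fin (n i) → ℂ} (hx : ∀ i, x i ≠ 0) (i : Fin p) :
    cofactor x i ≠ 0 := by
  choose a ha using fun i => Function.ne_iff.mp (hx i)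
  exact fun h => Finset.prod_ne_zero_iff.mpr (fun l _ => ha l) (congrFun h a)

/-- Removing a summand with two nonisotropic factors lowers the rank. -/
theorem tensorRank_sum_succAbove_lt (hp : 0 < p) {m R : ℕ}
    {x : Fin (m + 1) → (i : Fin p) → Fin (n i) → ℂ} (hx : ∀ k i, x k i ≠ 0)
    (horth : ∀ i k l, k ≠ l → complexForm (G i) (x k i) (x l i) = 0) {k : Fin (m + 1)}
    {i j : Fin p} (hij : i ≠ j) (hi : complexForm (G i) (x k i) (x k i) ≠ 0)
    (hj : complexForm (G j) (x k j) (x k j) ≠ 0) (hR : tensorRank (∑ l, outer (x l)) ≤ R) :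
    tensorRank (∑ l, outer (x (k.succAbove l))) + 1 ≤ R := by
  have hdual : ∀ i, complexForm (G i) (x k i) (x k i) ≠ 0 → ∀ l,
      dualVector G i (x k i) ⬝ᵥ x l i = if l = k then 1 else 0 := fun i hi l => by
    rw [dualVector_dotProduct]
    split_ifs with h
    · rw [h, inv_mul_cancel₀ hi]
    · rw [horth i k l (Ne.symm h), mul_zero]
  set T := ∑ l, outer (x l) with hT
  have hcon : contract i (dualVector G i (x k i)) T = cofactor (x k) i := by
    rw [hT, map_sum, Finset.sum_eq_single k]
    · rw [contract_outer, hdual i hi, if_pos rfl, one_smul]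
    · intro l _ hl
      rw [contract_outer, hdual i hi, if_neg hl, zero_smul]
    · simp
  obtain ⟨σ, -, hσ⟩ := exists_substitution hp i hR (P := 1)
    (by rw [actAt, Function.update_eq_self_iff.mpr rfl, act_one])
    (κ := Unit) (fun _ => dualVector G i (x k i)) (by
      rw [linearIndependent_unique_iff, hcon]
      exact cofactor_ne_zero (hx k) i)
  simp only [Finset.univ_unique, Finset.sum_singleton, Matrix.one_mulVec, hcon,
    Fintype.card_unique] at hσ
  -- The projection along x k j. It kills both the k-th summand and the subtracted tensor, whose
  -- factor in position j is still x k j because i ≠ j, and it fixes all other summands.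
  let E : Matrix (Fin (n j)) (Fin (n j)) ℂ :=
    1 - Matrix.vecMulVec (x k j) (dualVector G j (x k j))
  have hE : ∀ v, E.mulVec v = v - (dualVector G j (x k j) ⬝ᵥ v) • x k j := fun v => by
    rw [Matrix.sub_mulVec, Matrix.one_mulVec, Matrix.vecMulVec_mulVec,
      op_smul_eq_smul]
  have hact : actAt j E (T - fun a => σ () (a i) * cofactor (x k) i a) =
      ∑ l, outer (x (k.succAbove l)) := by
    have h1 : (fun a => σ () (a i) * cofactor (x k) i a) =
        outer (Function.update (x k) i (σ ())) := funext fun a => (outer_update_apply _ _ _ _).symm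
    rw [h1, map_sub, hT, map_sum, Fin.sum_univ_succAbove _ k, actAt_outer, actAt_outer, hE, hE,
      Function.update_of_ne hij.symm, hdual j hj, if_pos rfl, one_smul, sub_self]
    rw [outer_eq_zero (i := j) (by simp), outer_eq_zero (i := j) (by simp), zero_add, sub_zero]
    refine Finset.sum_congr rfl fun l _ => ?_
    rw [actAt_outer, hE, hdual j hj, if_neg (Fin.succAbove_ne k l), zero_smul, sub_zero,
      Function.update_eq_self]
  have h2 := tensorRank_act_le hp (Function.update (fun _ => 1) j E)
    (T - fun a => σ () (a i) * cofactor (x k) i a)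
  change tensorRank (actAt j E _) ≤ _ at h2
  rw [hact] at h2
  exact (Nat.add_le_add_right h2 1).trans hσ

end

end TensorData

/-! ### Orthogonalizing terms that are isotropic off one position -/

namespace TensorData

section

variable {p : ℕ} {n : Fin p → ℕ} {G : (i : Fin p) → Matrix (Fin (n i)) (Fin (n i)) ℝ}

/-- The complex bilinear form of a Gram matrix as a bilinear map. -/
noncomputable def formBilin (G : (i : Fin p) → Matrix (Fin (n i)) (Fin (n i)) ℝ) (i : Fin p) :
    LinearMap.BilinForm ℂ (Fin (n i) → ℂ) :=
  LinearMap.mk₂ ℂ (complexForm (G i))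
    (fun x y z => by simp [complexForm, add_mul, mul_add, Finset.sum_add_distrib])
    (fun c x y => by simp [complexForm, Finset.mul_sum, mul_left_comm, mul_assoc])
    (fun x y z => by simp [complexForm, mul_add, Finset.sum_add_distrib])
    (fun c x y => by simp [complexForm, Finset.mul_sum, mul_left_comm])

theorem exists_projector {m : ℕ} (S : Submodule ℂ (Fin m → ℂ)) :
    ∃ P : Matrix (Fin m) (Fin m) ℂ, (∀ v, P.mulVec v ∈ S) ∧ ∀ v ∈ S, P.mulVec v = v := by
  classical
  obtain ⟨q, hq⟩ := S.exists_isCompl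
  refine ⟨LinearMap.toMatrix' (S.subtype ∘ₗ S.projectionOnto q hq), fun v => ?_, fun v hv => ?_⟩
  · rw [LinearMap.toMatrix'_mulVec]
    exact (S.projectionOnto q hq v).2
  · rw [LinearMap.toMatrix'_mulVec, LinearMap.comp_apply]
    exact congrArg Subtype.val (Submodule.projectionOnto_apply_left hq ⟨v, hv⟩)

theorem complexForm_eq_zero_of_mem_span {i : Fin p} {S T : Set (Fin (n i) → ℂ)}
    (h : ∀ x ∈ S, ∀ y ∈ T, complexForm (G i) x y = 0) {u v : Fin (n i) → ℂ}
    (hu : u ∈ Submodule.span ℂ S) (hv : v ∈ Submodule.span ℂ T) : complexForm (G i) u v = 0 := by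
  have h1 : ∀ x ∈ S, complexForm (G i) x v = 0 := fun x hx => by
    have : Submodule.span ℂ T ≤ LinearMap.ker (formBilin G i x) :=
      Submodule.span_le.mpr fun y hy => h x hx y hy
    exact this hv
  have : Submodule.span ℂ S ≤ LinearMap.ker ((formBilin G i).flip v) :=
    Submodule.span_le.mpr fun x hx => h1 x hx
  exact this hu

/-- In a matrix-like decomposition the factors in position `j` can be made orthogonal. -/
theorem exists_twoOrthogonal_sum (hp2 : 2 ≤ p) (hG : ∀ i, (G i).PosDef)
    {U S : (i : Fin p) → Submodule ℂ (Fin (n i) → ℂ)}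
    (hSS : ∀ i, ∀ u ∈ S i, ∀ v ∈ S i, complexForm (G i) u v = 0) (j : Fin p) {d : ℕ}
    (z : Fin d → (i : Fin p) → Fin (n i) → ℂ) (hzj : ∀ l, z l j ∈ U j)
    (hz : ∀ l i, i ≠ j → z l i ∈ S i) :
    ∃ y : Fin d → (i : Fin p) → Fin (n i) → ℂ, ∑ l, outer (y l) = ∑ l, outer (z l) ∧
      (∀ l, y l j ∈ U j) ∧ (∀ l i, i ≠ j → y l i ∈ S i) ∧
      ∀ k l, k ≠ l → TwoOrthogonal G (y k) (y l) := by
  classical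
  -- For p ≥ 3 two positions other than j already give orthogonality. For p = 2 there is only one,
  -- and the terms form a matrix whose factors in position j can be rewritten in an orthogonal
  -- basis.
  rcases Nat.lt_or_ge 2 p with hp3 | hp3
  · obtain ⟨i, i', hij, hi'j, hii'⟩ : ∃ i i' : Fin p, i ≠ j ∧ i' ≠ j ∧ i ≠ i' := by
      have : 1 < (Finset.univ.erase j).card := by
        rw [Finset.card_erase_of_mem (Finset.mem_univ j), Finset.card_univ, Fintype.card_fin]
        omega
      obtain ⟨i, hi, i', hi', h⟩ := Finset.one_lt_card.mp this
      exact ⟨i, i', Finset.ne_of_mem_erase hi, Finset.ne_of_mem_erase hi', h⟩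
    exact ⟨z, rfl, hzj, hz, fun k l _ => ⟨i, i', hii', hSS i _ (hz k i hij) _ (hz l i hij),
      hSS i' _ (hz k i' hi'j) _ (hz l i' hi'j)⟩⟩
  · obtain ⟨i, hij, hi⟩ : ∃ i : Fin p, i ≠ j ∧ ∀ l, l ≠ j → l = i := by
      have : (Finset.univ.erase j).card = 1 := by
        rw [Finset.card_erase_of_mem (Finset.mem_univ j), Finset.card_univ, Fintype.card_fin]
        omega
      obtain ⟨i, hi⟩ := Finset.card_eq_one.mp this
      refine ⟨i, Finset.ne_of_mem_erase (hi ▸ Finset.mem_singleton_self i), fun l hl => ?_⟩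
      exact Finset.mem_singleton.mp (hi ▸ Finset.mem_erase.mpr ⟨hl, Finset.mem_univ l⟩)
    have hcof : ∀ (x : (i : Fin p) → Fin (n i) → ℂ) a, cofactor x j a = x i (a i) := fun x a =>
      Finset.prod_eq_single i (fun l hl h => absurd (hi l (Finset.ne_of_mem_erase hl)) h)
        fun h => absurd (Finset.mem_erase.mpr ⟨hij, Finset.mem_univ i⟩) h
    let E := Submodule.span ℂ (Set.range fun l => z l j)
    have hzE : ∀ l, z l j ∈ E := fun l => Submodule.subset_span ⟨l, rfl⟩
    have hEU : E ≤ U j := Submodule.span_le.mpr (by rintro _ ⟨l, rfl⟩; exact hzj l)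
    have : Invertible (2 : ℂ) := invertibleOfNonzero two_ne_zero
    -- The form on E may be degenerate; an orthogonal basis exists nonetheless, and its vectors may
    -- be isotropic.
    obtain ⟨v, hv⟩ := LinearMap.BilinForm.exists_orthogonal_basis
      (B := (formBilin G j).domRestrict₁₂ E E)
      ⟨fun a b => complexForm_comm hG j a b⟩
    have hd : Module.finrank ℂ E ≤ d := (finrank_range_le_card _).trans_eq (Fintype.card_fin d)
    obtain ⟨f, hf⟩ := Nat.exists_eq_add_of_le hd
    let r : Fin d → Fin (Module.finrank ℂ E) → ℂ := fun l => v.repr ⟨z l j, hzE l⟩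
    have hr : ∀ l, ∑ t, r l t • (v t : Fin (n j) → ℂ) = z l j := fun l => by
      have := congrArg E.subtype (v.sum_repr ⟨z l j, hzE l⟩)
      rw [map_sum] at this
      exact this
    let y₀ : Fin (Module.finrank ℂ E) → (i : Fin p) → Fin (n i) → ℂ := fun t =>
      Function.update (Function.update 0 i (∑ l, r l t • z l i)) j (v t)
    have hy₀j : ∀ t, y₀ t j = v t := fun t => Function.update_self _ _ _
    have hy₀i : ∀ t, y₀ t i = ∑ l, r l t • z l i := fun t => by
      simp only [y₀]
      rw [Function.update_of_ne hij, Function.update_self]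
    have hsum : ∑ t, outer (y₀ t) = ∑ l, outer (z l) := by
      funext a
      rw [Finset.sum_apply, Finset.sum_apply]
      simp only [outer_apply_eq _ j, hcof, hy₀j, hy₀i]
      simp only [← hr, Finset.sum_apply, Pi.smul_apply, smul_eq_mul, Finset.mul_sum, Finset.sum_mul]
      rw [Finset.sum_comm]
      exact Finset.sum_congr rfl fun l _ => Finset.sum_congr rfl fun t _ => by ring
    let y : Fin (Module.finrank ℂ E + f) → (i : Fin p) → Fin (n i) → ℂ := Fin.append y₀ fun _ => 0
    have hyS : ∀ s l, l ≠ j → y s l ∈ S l := by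
      intro s l hl
      obtain rfl := hi l hl
      refine Fin.addCases (fun t => ?_) (fun t => ?_) s
      · simp only [y, Fin.append_left, hy₀i]
        exact Submodule.sum_mem _ fun k _ => Submodule.smul_mem _ _ (hz k l hl)
      · simp only [y, Fin.append_right]
        exact Submodule.zero_mem _
    have hyU : ∀ s, y s j ∈ U j := by
      intro s
      refine Fin.addCases (fun t => ?_) (fun t => ?_) s
      · simp only [y, Fin.append_left, hy₀j]
        exact hEU (v t).2
      · simp only [y, Fin.append_right]
        exact Submodule.zero_mem _
    have hyo : ∀ s t, s ≠ t → complexForm (G j) (y s j) (y t j) = 0 := by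
      intro s t
      refine Fin.addCases (fun s => ?_) (fun s => ?_) s <;>
        refine Fin.addCases (fun t => ?_) (fun t => ?_) t <;> intro hst <;>
        simp only [y, Fin.append_left, Fin.append_right, hy₀j]
      · exact hv fun h => hst (by rw [h])
      · simp [complexForm]
      · simp [complexForm]
      · simp [complexForm]
    have hysum : ∑ s, outer (y s) = ∑ l, outer (z l) := by
      rw [Fin.sum_univ_add, ← hsum]
      simp only [y, Fin.append_left, Fin.append_right]
      rw [outer_eq_zero (i := j) rfl, Finset.sum_const_zero, add_zero]
    refine ⟨fun l => y (Fin.cast hf l), ?_, fun l => hyU _, fun l i => hyS _ i, fun k l hkl => ?_⟩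
    · rw [← hysum]
      exact Equiv.sum_comp (finCongr hf) fun s => outer (y s)
    · exact ⟨i, j, hij, hSS i _ (hyS _ i hij) _ (hyS _ i hij),
        hyo _ _ fun h => hkl (Fin.cast_injective hf h)⟩

end

end TensorData

/-! ### Splitting off nonisotropic factors and part (c) -/

namespace TensorData

section

variable {p : ℕ} {n : Fin p → ℕ} {G : (i : Fin p) → Matrix (Fin (n i)) (Fin (n i)) ℝ}

/-- The summands that are nonisotropic in position `j` only can be split off: subtracting `d`
decomposable tensors lowers the rank by `d` and leaves isotropic terms in their place. -/
theorem exists_peel (hp : 0 < p) {U S : (i : Fin p) → Submodule ℂ (Fin (n i) → ℂ)} (j : Fin p)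
    (hSU : S j ≤ U j) (hUS : ∀ u ∈ U j, ∀ v ∈ S j, complexForm (G j) u v = 0)
    {κ : Type} [Fintype κ] {x : κ → (i : Fin p) → Fin (n i) → ℂ}
    (horth : ∀ k l, k ≠ l → complexForm (G j) (x k j) (x l j) = 0)
    (hxj : ∀ k, complexForm (G j) (x k j) (x k j) ≠ 0)
    (hxU : ∀ k, x k j ∈ U j) (hxS : ∀ k i, i ≠ j → x k i ∈ S i) {T : Tensor n}
    (hT : T ∈ Submodule.span ℂ (outer '' {z | z j ∈ S j})) {R : ℕ}
    (hR : tensorRank (T + ∑ k, outer (x k)) ≤ R) :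
    ∃ (d R' : ℕ) (z : Fin d → (i : Fin p) → Fin (n i) → ℂ) (D : Tensor n), R' + d = R ∧
      (∀ l, z l j ∈ U j) ∧ (∀ l i, i ≠ j → z l i ∈ S i) ∧
      D ∈ Submodule.span ℂ (outer '' {z | ∀ i, z i ∈ S i}) ∧
      T + ∑ k, outer (x k) = T + D + ∑ l, outer (z l) ∧ tensorRank (T + D) ≤ R' := by
  classical
  obtain ⟨ι, a, ha, hsp, hli⟩ := exists_linearIndependent' ℂ fun k => cofactor (x k) j
  have : Fintype ι := Fintype.ofInjective a ha
  have hmem : ∀ k, cofactor (x k) j ∈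
      Submodule.span ℂ (Set.range ((fun k => cofactor (x k) j) ∘ a)) := fun k => by
    rw [hsp]; exact Submodule.subset_span ⟨k, rfl⟩
  let c : κ → ι → ℂ := fun k => hli.repr ⟨_, hmem k⟩
  have hc : ∀ k, ∑ l, c k l • cofactor (x (a l)) j = cofactor (x k) j := fun k => by
    have := hli.linearCombination_repr ⟨_, hmem k⟩
    rw [Finsupp.linearCombination_apply, Finsupp.sum_fintype _ _ (by simp)] at this
    exact this
  have hca : ∀ l' l, c (a l') l = if l' = l then 1 else 0 := fun l' l => by
    simp only [c]
    rw [hli.repr_eq_single l' ⟨_, hmem (a l')⟩ rfl, Finsupp.single_apply]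
  -- Expanding all cofactors in an independent subfamily regroups the sum into one term per member,
  -- with factor b l in position j.
  let b : ι → Fin (n j) → ℂ := fun l => ∑ k, c k l • x k j
  have hbU : ∀ l, b l ∈ U j := fun l =>
    Submodule.sum_mem _ fun k _ => Submodule.smul_mem _ _ (hxU k)
  have hsum : ∑ k, outer (x k) = ∑ l, outer (Function.update (x (a l)) j (b l)) := by
    funext s
    rw [Finset.sum_apply, Finset.sum_apply]
    have h1 : ∀ k, outer (x k) s = ∑ l, x k j (s j) * (c k l * cofactor (x (a l)) j s) := fun k => by
      rw [outer_apply_eq _ j, ← hc k, Finset.sum_apply, Finset.mul_sum]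
      rfl
    simp only [h1, outer_update_apply, b, Finset.sum_apply, Pi.smul_apply, smul_eq_mul,
      Finset.sum_mul]
    rw [Finset.sum_comm]
    exact Finset.sum_congr rfl fun l _ => Finset.sum_congr rfl fun k _ => by ring
  let β : ι → Fin (n j) → ℂ := fun l => dualVector G j (x (a l) j)
  have hβx : ∀ l k, β l ⬝ᵥ x k j = if k = a l then 1 else 0 := fun l k => by
    simp only [β, dualVector_dotProduct]
    split_ifs with h
    · rw [h, inv_mul_cancel₀ (hxj _)]
    · rw [horth _ _ (Ne.symm h), mul_zero]
  have hβS : ∀ l, ∀ v ∈ S j, β l ⬝ᵥ v = 0 := fun l v hv => by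
    simp only [β, dualVector_dotProduct]
    rw [hUS _ (hxU _) _ hv, mul_zero]
  have hβb : ∀ l l', β l ⬝ᵥ b l' = if l = l' then 1 else 0 := fun l l' => by
    simp only [b, dotProduct_sum, dotProduct_smul, hβx, smul_eq_mul]
    rw [Finset.sum_eq_single (a l)]
    · simp [hca]
    · intro k _ hk
      simp [hk]
    · simp
  have hcon : ∀ l, contract j (β l) (T + ∑ k, outer (x k)) = cofactor (x (a l)) j := fun l => by
    have h0 : contract j (β l) T = 0 := by
      have : Submodule.span ℂ (outer '' {z | z j ∈ S j}) ≤
          LinearMap.ker (contract (n := n) j (β l)) := by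
        refine Submodule.span_le.mpr ?_
        rintro _ ⟨z, hz, rfl⟩
        change contract j (β l) (outer z) = 0
        rw [contract_outer, hβS l _ hz, zero_smul]
      exact this hT
    rw [map_add, h0, zero_add, map_sum, Finset.sum_eq_single (a l)]
    · rw [contract_outer, hβx, if_pos rfl, one_smul]
    · intro k _ hk
      rw [contract_outer, hβx, if_neg hk, zero_smul]
    · simp
  -- The projector onto E fixes the tensor and keeps the substituted vectors in E. There the
  -- functionals β, dual to the b l and zero on S j, determine them modulo S j.
  let E : Submodule ℂ (Fin (n j) → ℂ) := Submodule.span ℂ (Set.range b) ⊔ S j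
  have hbE : ∀ l, b l ∈ E := fun l => Submodule.mem_sup_left (Submodule.subset_span ⟨l, rfl⟩)
  have hSE : S j ≤ E := le_sup_right
  have hEU : E ≤ U j := sup_le (Submodule.span_le.mpr (by rintro _ ⟨l, rfl⟩; exact hbU l)) hSU
  obtain ⟨P, hPE, hP⟩ := exists_projector E
  have hact : actAt j P (T + ∑ k, outer (x k)) = T + ∑ k, outer (x k) := by
    have h0 : actAt j P T = T := by
      have : Submodule.span ℂ (outer '' {z | z j ∈ S j}) ≤
          LinearMap.eqLocus (actAt (n := n) j P) LinearMap.id := by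
        refine Submodule.span_le.mpr ?_
        rintro _ ⟨z, hz, rfl⟩
        change actAt j P (outer z) = outer z
        rw [actAt_outer, hP _ (hSE hz), Function.update_eq_self]
      exact this hT
    rw [map_add, h0, hsum, map_sum]
    congr 1
    refine Finset.sum_congr rfl fun l _ => ?_
    rw [actAt_outer, Function.update_self, hP _ (hbE l), Function.update_idem]
  obtain ⟨σ, hσ, hrank⟩ := exists_substitution hp j hR hact β (by
    simp only [hcon]
    exact hli)
  have hbσ : ∀ l, b l - P.mulVec (σ l) ∈ S j := fun l => by
    obtain ⟨w, hw, s, hs, hws⟩ := Submodule.mem_sup.mp (hPE (σ l))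
    obtain ⟨e, rfl⟩ := (Submodule.mem_span_range_iff_exists_fun ℂ).mp hw
    have he : ∀ k, e k = if k = l then 1 else 0 := fun k => by
      rw [← hσ k l, ← hws, dotProduct_add, hβS k s hs, add_zero, dotProduct_sum]
      simp [dotProduct_smul, hβb]
    rw [← hws]
    simp only [he, ite_smul, one_smul, zero_smul, Finset.sum_ite_eq', Finset.mem_univ, if_true]
    rw [sub_add_cancel_left]
    exact Submodule.neg_mem _ hs
  let e := Fintype.equivFin ι
  let z : ι → (i : Fin p) → Fin (n i) → ℂ := fun l => Function.update (x (a l)) j (P.mulVec (σ l))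
  have hz : ∀ l i, i ≠ j → z l i ∈ S i := fun l i hi => by
    simp only [z]
    rw [Function.update_of_ne hi]
    exact hxS _ i hi
  -- The error of replacing b l by the substituted vector lies in S j, so these terms have all
  -- factors in the isotropic spans and can be absorbed into T.
  let D : Tensor n := ∑ l, outer (Function.update (x (a l)) j (b l - P.mulVec (σ l)))
  have hD : T + ∑ k, outer (x k) = T + D + ∑ l, outer (z l) := by
    rw [add_assoc, hsum, ← Finset.sum_add_distrib]
    congr 1
    refine Finset.sum_congr rfl fun l _ => ?_
    rw [← outer_update_add, sub_add_cancel]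
  have hrank' : tensorRank (T + D) + Fintype.card ι ≤ R := by
    refine le_of_eq_of_le ?_ hrank
    congr 2
    refine eq_sub_of_add_eq ?_
    rw [hD]
    congr 1
    refine Finset.sum_congr rfl fun l _ => ?_
    funext s
    rw [← hD, hcon, outer_update_apply]
  refine ⟨Fintype.card ι, R - Fintype.card ι, fun l => z (e.symm l), D, by omega,
    fun l => ?_, fun l => hz _, ?_, ?_, by omega⟩
  · simp only [z, Function.update_self]
    exact hEU (hPE _)
  · refine Submodule.sum_mem _ fun l _ => Submodule.subset_span ⟨_, fun i => ?_, rfl⟩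
    by_cases hi : i = j
    · subst hi
      rw [Function.update_self]
      exact hbσ l
    · rw [Function.update_of_ne hi]
      exact hxS _ i hi
  · rw [hD, Equiv.sum_comp e.symm fun l => outer (z l)]

/-- A weakly orthogonal sum in which every summand has at most one nonisotropic factor has a
decomposition of minimal length into terms that are pairwise orthogonal in two positions. -/
theorem exists_twoOrthogonal_decomposition (hp2 : 2 ≤ p) (hG : ∀ i, (G i).PosDef)
    {U S : (i : Fin p) → Submodule ℂ (Fin (n i) → ℂ)} (hSU : ∀ i, S i ≤ U i)
    (hUS : ∀ i, ∀ u ∈ U i, ∀ v ∈ S i, complexForm (G i) u v = 0)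
    {m : ℕ} {x : Fin m → (i : Fin p) → Fin (n i) → ℂ} (hxU : ∀ k i, x k i ∈ U i)
    (hxS : ∀ k i, complexForm (G i) (x k i) (x k i) = 0 → x k i ∈ S i)
    (horth : ∀ i k l, k ≠ l → complexForm (G i) (x k i) (x l i) = 0)
    (h1 : ∀ k i j, complexForm (G i) (x k i) (x k i) ≠ 0 →
      complexForm (G j) (x k j) (x k j) ≠ 0 → i = j) (J : Finset (Fin p)) {s : Finset (Fin m)}
    (hs : ∀ k, k ∈ s ↔ ∃ j ∈ J, complexForm (G j) (x k j) (x k j) ≠ 0) {T : Tensor n}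
    (hT : T ∈ Submodule.span ℂ (outer '' {z | ∀ i, z i ∈ S i})) {R : ℕ}
    (hR : tensorRank (T + ∑ k ∈ s, outer (x k)) ≤ R) :
    ∃ y : Fin R → (i : Fin p) → Fin (n i) → ℂ, T + ∑ k ∈ s, outer (x k) = ∑ k, outer (y k) ∧
      (∀ k i, y k i ∈ U i) ∧ (∀ k, ∀ i ∉ J, y k i ∈ S i) ∧
      ∀ k l, k ≠ l → TwoOrthogonal G (y k) (y l) := by
  classical
  have hp : 0 < p := by omega
  have hSS : ∀ i, ∀ u ∈ S i, ∀ v ∈ S i, complexForm (G i) u v = 0 := fun i u hu =>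
    hUS i u (hSU i hu)
  have hSU' : ∀ i, ∀ u ∈ S i, ∀ v ∈ U i, complexForm (G i) u v = 0 := fun i u hu v hv => by
    rw [complexForm_comm hG]
    exact hUS i v hv u hu
  induction J using Finset.induction_on generalizing s T R with
  | empty =>
    obtain rfl : s = ∅ := Finset.eq_empty_of_forall_notMem fun k hk => by simpa using (hs k).mp hk
    rw [Finset.sum_empty, add_zero] at hR ⊢
    -- T has all its factors in the spans S i, so any decomposition can be projected there, and
    -- vectors of S i are mutually orthogonal.
    choose P hPS hP using fun i => exists_projector (S i)
    obtain ⟨y, hy⟩ := (tensorRank_le_iff hp).mp hR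
    have hPT : act P T = T := by
      have : Submodule.span ℂ (outer '' {z | ∀ i, z i ∈ S i}) ≤
          LinearMap.eqLocus (act (n := n) P) LinearMap.id := by
        refine Submodule.span_le.mpr ?_
        rintro _ ⟨z, hz, rfl⟩
        change act P (outer z) = outer z
        rw [act_outer]
        exact congrArg outer (funext fun i => hP i _ (hz i))
      exact this hT
    refine ⟨fun k i => (P i).mulVec (y k i), ?_, fun k i => hSU i (hPS i _), fun k i _ => hPS i _,
      fun k l _ => ⟨⟨0, hp⟩, ⟨1, hp2⟩, by simp, hSS _ _ (hPS _ _) _ (hPS _ _),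
        hSS _ _ (hPS _ _) _ (hPS _ _)⟩⟩
    conv_lhs => rw [← hPT, hy, map_sum]
    simp only [act_outer]
  | insert j J hj ih =>
    -- The summands isotropic in position j. Those left out have j as their only nonisotropic
    -- position and are the ones split off at this stage.
    let s₀ := s.filter fun k => complexForm (G j) (x k j) (x k j) = 0
    have hs₀ : ∀ k, k ∈ s₀ ↔ ∃ i ∈ J, complexForm (G i) (x k i) (x k i) ≠ 0 := by
      intro k
      simp only [s₀, Finset.mem_filter, hs, Finset.mem_insert]
      constructor
      · rintro ⟨⟨i, rfl | hi, hik⟩, hk⟩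
        · exact absurd hk hik
        · exact ⟨i, hi, hik⟩
      · rintro ⟨i, hi, hik⟩
        refine ⟨⟨i, .inr hi, hik⟩, ?_⟩
        by_contra h
        exact hj (h1 k i j hik h ▸ hi)
    let κ := {k // k ∈ s.filter fun k => ¬ complexForm (G j) (x k j) (x k j) = 0}
    have hκ : ∀ k : κ, complexForm (G j) (x k.1 j) (x k.1 j) ≠ 0 := fun k =>
      (Finset.mem_filter.mp k.2).2
    have hsplit : T + ∑ k ∈ s, outer (x k) =
        T + ∑ k ∈ s₀, outer (x k) + ∑ k : κ, outer (x k.1) := by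
      rw [add_assoc, ← Finset.sum_filter_add_sum_filter_not s
        (fun k => complexForm (G j) (x k j) (x k j) = 0)]
      congr 2
      exact (Finset.sum_coe_sort _ fun k => outer (x k)).symm
    rw [hsplit] at hR ⊢
    obtain ⟨d, R', z, D, rfl, hzU, hzS, hD, hsum, hrank⟩ := exists_peel hp j (hSU j) (hUS j)
      (x := fun k : κ => x k.1) (fun k l hkl => horth j _ _ fun h => hkl (Subtype.ext h)) hκ
      (fun k => hxU _ _) (fun k i hi => hxS _ _ (by
        by_contra h
        exact hi (h1 _ _ _ h (hκ k))))
      (T := T + ∑ k ∈ s₀, outer (x k)) (by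
        refine Submodule.add_mem _ (Submodule.span_mono (Set.image_mono
          fun (z : (i : Fin p) → Fin (n i) → ℂ) (hz : ∀ i, z i ∈ S i) => hz j) hT)
          (Submodule.sum_mem _ fun k hk => Submodule.subset_span ⟨_, ?_, rfl⟩)
        exact hxS k j (Finset.mem_filter.mp hk).2) hR
    obtain ⟨y', hy', hyU', hyS', hyo'⟩ := exists_twoOrthogonal_sum hp2 hG hSS j z hzU hzS
    rw [add_right_comm] at hrank
    obtain ⟨y, hy, hyU, hyS, hyo⟩ := ih hs₀ (Submodule.add_mem _ hT hD) hrank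
    have hyU'' : ∀ l i, y' l i ∈ U i := fun l i => by
      by_cases hi : i = j
      · subst hi; exact hyU' l
      · exact hSU i (hyS' l i hi)
    -- In every position one of the two factors is in S i and the other in U i: for position j it is
    -- the old term that is in S, elsewhere the new one.
    have hcross : ∀ k l i, complexForm (G i) (y k i) (y' l i) = 0 := fun k l i => by
      by_cases hi : i = j
      · subst hi; exact hSU' i _ (hyS k i hj) _ (hyU' l)
      · exact hUS i _ (hyU k i) _ (hyS' l i hi)
    refine ⟨Fin.append y y', ?_, fun k i => ?_, fun k i hi => ?_, fun k l => ?_⟩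
    · rw [hsum, Fin.sum_univ_add, add_right_comm T _ D, hy]
      simp only [Fin.append_left, Fin.append_right, hy']
    · refine Fin.addCases (fun k => ?_) (fun k => ?_) k
      · rw [Fin.append_left]; exact hyU k i
      · rw [Fin.append_right]; exact hyU'' k i
    · rw [Finset.mem_insert, not_or] at hi
      refine Fin.addCases (fun k => ?_) (fun k => ?_) k
      · rw [Fin.append_left]; exact hyS k i hi.2
      · rw [Fin.append_right]; exact hyS' k i hi.1
    · refine Fin.addCases (fun k => ?_) (fun k => ?_) k <;>
        refine Fin.addCases (fun l => ?_) (fun l => ?_) l <;> intro hkl <;>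
        simp only [Fin.append_left, Fin.append_right]
      · exact hyo _ _ fun h => hkl (by rw [h])
      · exact ⟨⟨0, hp⟩, ⟨1, hp2⟩, by simp, hcross _ _ _, hcross _ _ _⟩
      · exact ⟨⟨0, hp⟩, ⟨1, hp2⟩, by simp, (complexForm_comm hG _ _ _).trans (hcross _ _ _),
          (complexForm_comm hG _ _ _).trans (hcross _ _ _)⟩
      · exact hyo' _ _ fun h => hkl (by rw [h])

/-- U i is the span of all factors in position i, and S i the span of the isotropic ones. Weak
orthogonality makes S i orthogonal to all of U i, itself included. -/
theorem weaklyOrth_mem_DL_of_isotropic (hp2 : 2 ≤ p) (hG : ∀ i, (G i).PosDef) {m r : ℕ}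
    (hr : 1 ≤ r) {x : Fin m → (i : Fin p) → Fin (n i) → ℂ}
    (horth : ∀ i k l, k ≠ l → complexForm (G i) (x k i) (x l i) = 0)
    (h1 : ∀ k i j, complexForm (G i) (x k i) (x k i) ≠ 0 →
      complexForm (G j) (x k j) (x k j) ≠ 0 → i = j)
    (hR : tensorRank (∑ k, outer (x k)) ≤ r) : ∑ k, outer (x k) ∈ DL G r := by
  classical
  let U : (i : Fin p) → Submodule ℂ (Fin (n i) → ℂ) := fun i =>
    Submodule.span ℂ (Set.range fun k => x k i)
  let S : (i : Fin p) → Submodule ℂ (Fin (n i) → ℂ) := fun i =>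
    Submodule.span ℂ ((fun k => x k i) '' {k | complexForm (G i) (x k i) (x k i) = 0})
  let s : Finset (Fin m) := Finset.univ.filter fun k =>
    ∃ j ∈ (Finset.univ : Finset (Fin p)), complexForm (G j) (x k j) (x k j) ≠ 0
  have hsplit : ∑ k, outer (x k) = ∑ k ∈ sᶜ, outer (x k) + ∑ k ∈ s, outer (x k) :=
    (Finset.sum_compl_add_sum s _).symm
  rw [hsplit] at hR ⊢
  obtain ⟨y, hy, -, -, hyo⟩ := exists_twoOrthogonal_decomposition hp2 hG (U := U) (S := S)
    (fun i => Submodule.span_mono (Set.image_subset_range _ _))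
    (fun i u hu v hv => complexForm_eq_zero_of_mem_span (by
      rintro _ ⟨k, rfl⟩ _ ⟨l, hl, rfl⟩
      by_cases hkl : k = l
      · subst hkl; exact hl
      · exact horth i k l hkl) hu hv)
    (fun k i => Submodule.subset_span ⟨k, rfl⟩)
    (fun k i hk => Submodule.subset_span ⟨k, hk, rfl⟩) horth h1 Finset.univ (s := s)
    (fun k => by simp [s])
    (T := ∑ k ∈ sᶜ, outer (x k)) (Submodule.sum_mem _ fun k hk => Submodule.subset_span
      ⟨_, fun i => Submodule.subset_span ⟨k, by
        by_contra h
        refine Finset.mem_compl.mp hk (Finset.mem_filter.mpr ⟨Finset.mem_univ k, i,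
          Finset.mem_univ i, h⟩), rfl⟩, rfl⟩) hR
  rw [hy]
  exact sum_outer_mem_DL (by omega) hG hr le_rfl y hyo

/-- Induction on the number of summands: while some summand has two nonisotropic factors it is
removed, lowering the rank bound by one, and added back by one data locus step. -/
theorem mem_DL_of_weaklyOrth (hp2 : 2 ≤ p) (hG : ∀ i, (G i).PosDef) {m r : ℕ}
    (hr : 1 ≤ r) {x : Fin m → (i : Fin p) → Fin (n i) → ℂ} (hx : ∀ k i, x k i ≠ 0)
    (horth : ∀ i k l, k ≠ l → complexForm (G i) (x k i) (x l i) = 0)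
    (hR : tensorRank (∑ k, outer (x k)) ≤ r) : ∑ k, outer (x k) ∈ DL G r := by
  have hp : 0 < p := by omega
  induction m generalizing r with
  | zero => exact weaklyOrth_mem_DL_of_isotropic hp2 hG hr horth (fun k => k.elim0) hR
  | succ m ih =>
    by_cases h : ∀ k i j, complexForm (G i) (x k i) (x k i) ≠ 0 →
      complexForm (G j) (x k j) (x k j) ≠ 0 → i = j
    · exact weaklyOrth_mem_DL_of_isotropic hp2 hG hr horth h hR
    push Not at h
    obtain ⟨k, i, j, hi, hj, hij⟩ := h
    have h2 := tensorRank_sum_succAbove_lt hp hx horth hij hi hj hR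
    obtain ⟨r, rfl⟩ := Nat.exists_eq_add_of_le' hr
    have h3 : tensorRank (∑ l, outer (x (k.succAbove l))) ≤ r := by omega
    rw [Fin.sum_univ_succAbove _ k, add_comm (outer (x k))]
    -- If the remaining bound is 0, the other summands add up to zero and the tensor is the single
    -- removed summand, in DL_1.
    rcases Nat.eq_zero_or_pos r with rfl | hr0
    · obtain ⟨y, hy⟩ := (tensorRank_le_iff hp).mp h3
      rw [hy, Finset.univ_eq_empty, Finset.sum_empty, zero_add (outer (x k))]
      exact ⟨_, rfl⟩
    · refine outer_add_mem_DL hp hG hr0 (ih hr0 (fun l => hx _)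
        (fun i l l' hll => horth i _ _ fun h => hll (Fin.succAbove_right_injective h)) h3)
        fun l v => ?_
      rw [bombieriWeyl_sum_right]
      refine Finset.sum_eq_zero fun l' _ => TwoOrthogonal.bombieriWeyl_update ?_ l v
      have hne : k ≠ k.succAbove l' := Fin.ne_succAbove k l'
      exact ⟨⟨0, hp⟩, ⟨1, hp2⟩, by simp, horth _ _ _ hne, horth _ _ _ hne⟩

/-- With a single factor every tensor is decomposable. -/
theorem mem_rankOne_of_subsingleton (hp : 0 < p) (hp1 : p ≤ 1) (T : Tensor n) :
    T ∈ rankOne n := by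
  obtain rfl : p = 1 := by omega
  refine ⟨fun i c => T fun l => Fin.cast (by rw [Subsingleton.elim i l]) c, ?_⟩
  funext a
  rw [outer, Fin.prod_univ_one]
  congr 1
  funext l
  obtain rfl : l = 0 := Subsingleton.elim _ _
  rfl

end

end TensorData

theorem mainTheorem6 {p : ℕ} (hp : 0 < p) (n : Fin p → ℕ)
    (G : (i : Fin p) → Matrix (Fin (n i)) (Fin (n i)) ℝ) (hG : ∀ i, (G i).PosDef)
    (r : ℕ) (hr : 1 ≤ r) :
    TensorData.DL G r ⊆ TensorData.DL G (r + 1) ∧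
    (∀ T ∈ TensorData.DL G r, TensorData.borderRank T ≤ r) ∧
    (∀ T : TensorData.Tensor n, TensorData.IsWeaklyOrthDecomposable G T →
      TensorData.tensorRank T ≤ r → T ∈ TensorData.DL G r) := by
  refine ⟨TensorData.DL_subset_succ hp hG hr,
    fun T hT => Nat.sInf_le (TensorData.DL_subset_zariskiClosure hp hG hr hT), ?_⟩
  rintro T ⟨m, x, hx, horth, rfl⟩ hR
  -- For p = 1 two orthogonal positions are not available, but then X is the whole space.
  rcases Nat.lt_or_ge 1 p with hp2 | hp1
  · exact TensorData.mem_DL_of_weaklyOrth hp2 hG hr hx horth hR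
  · exact TensorData.DL_mono hp hG le_rfl hr (TensorData.mem_rankOne_of_subsingleton hp hp1 _)
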